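/- Consider $M\ge 1$ stations numbered $1,\dots,M$, each with an infinite queue of "red" and an infinite queue of "green" messages. Time is slotted, $t=1,2,\dots$, and a transmission takes one slot. In slot $t$ the station $i(t)=((t-1)\bmod M)+1$ transmits one red message (successfully) if its red queue is non-empty at the beginning of the slot; no other station transmits a red message. Every station that is not transmitting a red message in this slot and whose green queue is non-empty attempts to transmit a green message with probability $p\in[0,1]$, independently of everything else. If exactly one station attempts a green transmission, it succeeds and the message leaves; if two or more do, all of these attempts fail and the messages stay in their queues. In slot $t$, $\xi^t$ new red and $\eta^t$ new green messages arrive (they can be transmitted from slot $t+1$ on), where $(\xi^t)_t$ and $(\eta^t)_t$ are independent i.i.d. sequences of non-negative integer random variables with finite means $\lambda_R=\mathbf E\xi^t$ and $\lambda_G=\mathbf E\eta^t$; every arriving message is assigned to a station chosen uniformly at random, independently of everything else. Let $R_i^t$ and $G_i^t$ be the numbers of red and green messages at station $i$ at the beginning of slot $t$, and consider the time-homogeneous Markov chain $X^t=(i(t),R_1^t,\dots,R_M^t,G_1^t,\dots,G_M^t)$ on the countable set $\{1,\dots,M\}\times\mathbb Z_{\ge 0}^{2M}$, which may be started in any state.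 For a set $V$ of states let $\tau_V$ be the number of steps $n\ge1$ until the chain, started in a given state, is in $V$ for the first time after the start. The set $V$ is called positive recurrent if $\tau_V<\infty$ with probability $1$ from every initial state and $\sup_{x\in V}\mathbf E_x\tau_V<\infty$. The system is called stable if the chain is positive recurrent, that is, if $\{z\}$ is positive recurrent for some state $z$. It is called unstable if no finite set of states is positive recurrent (in particular, it is then not stable). Theorem. Assume $\lambda_R<1$. The system is stable if $$\begin{cases}\lambda_G<(1-\lambda_R)\,p, & M=1,\\ \lambda_G<\lambda_R(M-1)p(1-p)^{M-2}+(1-\lambda_R)Mp(1-p)^{M-1}, & M>1,\end{cases}$$ and it is unstable if the opposite strict inequality holds (with $0^0=1$ when $p=1$ and $M=2$). -/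

import Mathlib

open MeasureTheory ProbabilityTheory
open scoped ENNReal

namespace AlohaMac

/-- State of the network with `M` stations (numbered `0, …, M - 1`) at the beginning of a slot:
the station whose turn it is to send a red message in this slot, and the numbers of red and of
green messages waiting at each station. Recording the turn makes the chain time-homogeneous. -/
@[ext]
structure State (M : ℕ) where
  turn : Fin M
  red : Fin M → ℕ
  green : Fin M → ℕ

/-- What happens in one slot: the numbers of new red and green messages at each station, and the
coin of each station (`true` means: transmit a green message, if possible). -/
structure SlotInput (M : ℕ) where
  redIn : Fin M → ℕ
  greenIn : Fin M → ℕ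
  coin : Fin M → Bool

variable {M : ℕ}

/-- Round-robin: the station whose turn comes next. -/
def nextStation (i : Fin M) : Fin M :=
  ⟨(i.val + 1) % M, Nat.mod_lt _ i.pos⟩

/-- Station `i` transmits a red message: it is its turn and its red queue is not empty. -/
abbrev SendsRed (x : State M) (i : Fin M) : Prop :=
  i = x.turn ∧ 0 < x.red i

/-- Station `i` attempts a green transmission: it has a green message, it is not transmitting a
red one (the MAC-coordinator gives priority to red), and its coin says so. -/
abbrev TriesGreen (x : State M) (u : SlotInput M) (i : Fin M) : Prop :=
  0 < x.green i ∧ ¬ SendsRed x i ∧ u.coin i = true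

/-- The green transmission of station `i` is successful: `i` is the only station that tries. -/
abbrev SendsGreen (x : State M) (u : SlotInput M) (i : Fin M) : Prop :=
  TriesGreen x u i ∧ ∀ j, j ≠ i → ¬ TriesGreen x u j

/-- The state at the beginning of the next slot. -/
def next (x : State M) (u : SlotInput M) : State M where
  turn := nextStation x.turn
  red i := (if SendsRed x i then x.red i - 1 else x.red i) + u.redIn i
  green i := (if SendsGreen x u i then x.green i - 1 else x.green i) + u.greenIn i

/-- The random quantities that drive a network with `M` stations. Slots and the messages that
arrive within a slot are numbered from `0`. -/
structure Inputs (Ω : Type*) (M : ℕ) where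
  /-- `redCount t`: total number of red messages that arrive in slot `t` -/
  redCount : ℕ → Ω → ℕ
  /-- `greenCount t`: total number of green messages that arrive in slot `t` -/
  greenCount : ℕ → Ω → ℕ
  /-- `redDest t k`: the station to which the red message number `k` of slot `t` is assigned -/
  redDest : ℕ → ℕ → Ω → Fin M
  /-- `greenDest t k`: the station to which the green message number `k` of slot `t` is assigned -/
  greenDest : ℕ → ℕ → Ω → Fin M
  /-- `coin t i`: the coin of station `i` in slot `t` -/
  coin : ℕ → Fin M → Ω → Bool

/-- Labels of the individual input variables. -/
inductive Label (M : ℕ) : Type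
  | redCount (t : ℕ)
  | greenCount (t : ℕ)
  | redDest (t k : ℕ)
  | greenDest (t k : ℕ)
  | coin (t : ℕ) (i : Fin M)

namespace Inputs

variable {Ω : Type*}

/-- All input variables as one family of random variables, with values coded in `ℕ`. -/
def value (D : Inputs Ω M) : Label M → Ω → ℕ
  | .redCount t => D.redCount t
  | .greenCount t => D.greenCount t
  | .redDest t k => fun ω => (D.redDest t k ω : ℕ)
  | .greenDest t k => fun ω => (D.greenDest t k ω : ℕ)
  | .coin t i => fun ω => (D.coin t i ω).toNat

/-- The probabilistic assumptions: the red batch sizes are i.i.d. with finite mean, so are the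
green ones, each message is assigned to a uniformly chosen station, each coin shows `true` with
probability `p`, and all these variables are mutually independent. -/
structure IsAdmissible [MeasurableSpace Ω] (D : Inputs Ω M) (P : Measure Ω) (p : ℝ) : Prop where
  measurable_redCount : ∀ t, Measurable (D.redCount t)
  measurable_greenCount : ∀ t, Measurable (D.greenCount t)
  measurable_redDest : ∀ t k, Measurable (D.redDest t k)
  measurable_greenDest : ∀ t k, Measurable (D.greenDest t k)
  measurable_coin : ∀ t i, Measurable (D.coin t i)
  identDistrib_redCount : ∀ t, IdentDistrib (D.redCount t) (D.redCount 0) P P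
  identDistrib_greenCount : ∀ t, IdentDistrib (D.greenCount t) (D.greenCount 0) P P
  integrable_redCount : Integrable (fun ω => (D.redCount 0 ω : ℝ)) P
  integrable_greenCount : Integrable (fun ω => (D.greenCount 0 ω : ℝ)) P
  redDest_uniform : ∀ t k i, P {ω | D.redDest t k ω = i} = (M : ℝ≥0∞)⁻¹
  greenDest_uniform : ∀ t k i, P {ω | D.greenDest t k ω = i} = (M : ℝ≥0∞)⁻¹
  coin_bernoulli : ∀ t i, P {ω | D.coin t i ω = true} = ENNReal.ofReal p
  indep : iIndepFun D.value P

/-- The input of slot `t`: messages are counted at the stations to which they are assigned. -/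
def slot (D : Inputs Ω M) (t : ℕ) (ω : Ω) : SlotInput M where
  redIn i := ((Finset.range (D.redCount t ω)).filter fun k => D.redDest t k ω = i).card
  greenIn i := ((Finset.range (D.greenCount t ω)).filter fun k => D.greenDest t k ω = i).card
  coin i := D.coin t i ω

/-- The Markov chain of the network, started in the state `x`. -/
def chain (D : Inputs Ω M) (x : State M) : ℕ → Ω → State M
  | 0, _ => x
  | t + 1, ω => next (D.chain x t ω) (D.slot t ω)

/-- `τ = min {t ≥ 1 : X^t ∈ V}` for the chain started in `x`, with `τ = ∞` if there is no such
`t`. -/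
noncomputable def returnTime (D : Inputs Ω M) (V : Set (State M)) (x : State M) (ω : Ω) : ℝ≥0∞ :=
  ⨅ (t : ℕ) (_ : 1 ≤ t ∧ D.chain x t ω ∈ V), (t : ℝ≥0∞)

/-- The set `V` is positive recurrent: it is reached with probability one from every initial
state, and the mean return times are bounded on `V`. -/
def PositiveRecurrentSet [MeasurableSpace Ω] (D : Inputs Ω M) (P : Measure Ω)
    (V : Set (State M)) : Prop :=
  (∀ x, ∀ᵐ ω ∂P, D.returnTime V x ω < ∞) ∧
    (⨆ x ∈ V, ∫⁻ ω, D.returnTime V x ω ∂P) < ∞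

/-- The system is stable: the chain (on a countable state space) is positive recurrent, that is,
some state is reached with probability one from every state and has a finite mean return time.
States that are left forever are allowed, as for instance when no green messages arrive. -/
def IsStable [MeasurableSpace Ω] (D : Inputs Ω M) (P : Measure Ω) : Prop :=
  ∃ z : State M, D.PositiveRecurrentSet P {z}

/-- The system is unstable: the chain is not positive recurrent; in fact not even a finite set of
states is positive recurrent. -/
def IsUnstable [MeasurableSpace Ω] (D : Inputs Ω M) (P : Measure Ω) : Prop :=
  ∀ V : Set (State M), V.Finite → ¬ D.PositiveRecurrentSet P V

theorem IsUnstable.not_isStable [MeasurableSpace Ω] {D : Inputs Ω M} {P : Measure Ω}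
    (h : D.IsUnstable P) : ¬ D.IsStable P :=
  fun ⟨z, hz⟩ => h {z} (Set.finite_singleton z) hz

end Inputs

end AlohaMac

/-! The red part of the network is autonomous: the turn and the red queues evolve without reference
to green messages (`chain_congr_red`). Each red queue receives `λ_R / M` messages per slot on
average and is offered one service in every `M` slots. As `λ_R < 1`, red queues are `o(t)`, almost
surely and in mean (`ae_tendsto_redQueue_empty`, `tendsto_integral_redQueue_empty`), so each station
sends red in a fraction `λ_R / M` of the slots.

Now compare with the saturated network, in which no green queue is ever empty. There the success
probability of station `j` depends on the state only through the identity of the red sender, and it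
is affine in the indicators of red transmissions (`rate`, `integral_saturated`). Summed over time,
the service is an affine function of the numbers of red transmissions plus a martingale with bounded
increments (`service_eq`). Hence each station has the service rate `serviceRate`, and `M` times this
rate is the threshold of the theorem (`natCast_mul_serviceRate`).

Instability: above the threshold, green arrivals minus saturated service tend to infinity at every
station, so this difference is bounded below by a random constant. If all green queues start
sufficiently high, they never come near zero; the network then coincides with the saturated one and
avoids any given finite set forever (`isUnstable_of_serviceRate_lt`).

Stability: `maxGreen + C * maxRed` has negative drift over a fixed large number `m` of slots outside
a finite set (`lyapunov_chain_le`). If some red queue is long, the decrease of `C * maxRed` pays for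
any growth of green. If all red queues are short, red throughput over `m` slots is close to its
mean. A green queue of length at least `m` cannot become empty in that time, and empty queues
elsewhere only remove competitors, so it is served at least as often as in the saturated network
(`green_chain_le_sub_service`). The errors are `o(m)` in mean, uniformly in the initial state
(`eventually_integral_deviation_le`).

Foster's criterion (`positiveRecurrentSet_of_drift`) then needs one state that is accessible from
everywhere (`exists_accessible`). The empty state is emptied into by favourable coins if `p < 1` or
`M = 1`. If `p = 1`, a positive threshold leaves only one other case, `M = 2` with `λ_R > 0`, where
red traffic silences one of the two stations. -/

open Filter Topology

namespace AlohaMac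

variable {M : ℕ}

/-! ### Countability and measurability of states and inputs -/

section Discrete

instance : Countable (State M) :=
  Function.Injective.countable (f := fun x : State M => (x.turn, x.red, x.green))
    (fun x y h => by
      simp only [Prod.mk.injEq] at h
      exact State.ext h.1 h.2.1 h.2.2)

instance : MeasurableSpace (State M) := ⊤

instance : DiscreteMeasurableSpace (State M) := ⟨fun _ => trivial⟩

instance : Countable (SlotInput M) :=
  Function.Injective.countable (f := fun u : SlotInput M => (u.redIn, u.greenIn, u.coin))
    (fun x y h => by
      cases x; cases y
      simp only [Prod.mk.injEq] at h
      obtain ⟨rfl, rfl, rfl⟩ := h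
      rfl)

instance : MeasurableSpace (SlotInput M) := ⊤

instance : DiscreteMeasurableSpace (SlotInput M) := ⟨fun _ => trivial⟩

end Discrete

/-! ### The input of a slot as a function of its variables -/

/-- Names of the input variables of a single slot. -/
inductive SlotLabel (M : ℕ) : Type
  | redCount
  | greenCount
  | redDest (k : ℕ)
  | greenDest (k : ℕ)
  | coin (i : Fin M)

/-- The label of a variable of slot `t`. -/
def SlotLabel.at (t : ℕ) : SlotLabel M → Label M
  | .redCount => .redCount t
  | .greenCount => .greenCount t
  | .redDest k => .redDest t k
  | .greenDest k => .greenDest t k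
  | .coin i => .coin t i

/-- The slot to which a label belongs. -/
def Label.time : Label M → ℕ
  | .redCount t => t
  | .greenCount t => t
  | .redDest t _ => t
  | .greenDest t _ => t
  | .coin t _ => t

lemma SlotLabel.time_at (t : ℕ) (a : SlotLabel M) : (a.at t).time = t := by
  cases a <;> rfl

lemma SlotLabel.at_injective (t : ℕ) : Function.Injective (SlotLabel.at (M := M) t) := by
  intro a b h
  cases a <;> cases b <;> simp_all [SlotLabel.at]

/-- The input of a slot, computed from the values of its variables. -/
def assemble (v : SlotLabel M → ℕ) : SlotInput M where
  redIn i := ((Finset.range (v .redCount)).filter fun k => v (.redDest k) = i).card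
  greenIn i := ((Finset.range (v .greenCount)).filter fun k => v (.greenDest k) = i).card
  coin i := decide (v (.coin i) = 1)

/-- The range of summation is random. Freezing it at each of its countably many values leaves finite
sums of indicators. -/
lemma measurable_card_filter {α : Type*} [MeasurableSpace α] {N : α → ℕ} {f : ℕ → α → ℕ}
    (hN : Measurable N) (hf : ∀ k, Measurable (f k)) (i : ℕ) :
    Measurable fun v => ((Finset.range (N v)).filter fun k => f k v = i).card := by
  have h : ∀ n : ℕ, Measurable fun v => ((Finset.range n).filter fun k => f k v = i).card := by
    intro n
    simp only [Finset.card_filter]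
    refine Finset.measurable_sum _ fun k _ => ?_
    exact Measurable.ite (hf k (measurableSet_singleton i)) measurable_const measurable_const
  exact (measurable_from_prod_countable_right (f := fun q : ℕ × α =>
    ((Finset.range q.1).filter fun k => f k q.2 = i).card) h).comp (hN.prodMk measurable_id)

lemma measurable_slotInput {α : Type*} [MeasurableSpace α] {f : α → SlotInput M}
    (h1 : ∀ i, Measurable fun a => (f a).redIn i) (h2 : ∀ i, Measurable fun a => (f a).greenIn i)
    (h3 : ∀ i, Measurable fun a => (f a).coin i) : Measurable f := by
  refine measurable_to_countable' fun u => ?_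
  have : f ⁻¹' {u} = (⋂ i, {a | (f a).redIn i = u.redIn i}) ∩
      ((⋂ i, {a | (f a).greenIn i = u.greenIn i}) ∩ ⋂ i, {a | (f a).coin i = u.coin i}) := by
    ext a
    simp only [Set.mem_preimage, Set.mem_singleton_iff, Set.mem_inter_iff, Set.mem_iInter,
      Set.mem_ofPred_eq]
    constructor
    · rintro rfl; simp
    · rintro ⟨ha, hb, hc⟩
      have ha := funext ha
      have hb := funext hb
      have hc := funext hc
      revert ha hb hc
      cases f a; cases u
      rintro rfl rfl rfl
      rfl
  rw [this]
  refine (MeasurableSet.iInter fun i => ?_).inter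
    ((MeasurableSet.iInter fun i => ?_).inter (MeasurableSet.iInter fun i => ?_))
  · exact h1 i (measurableSet_singleton _)
  · exact h2 i (measurableSet_singleton _)
  · exact h3 i (measurableSet_singleton _)

lemma measurable_assemble : Measurable (assemble (M := M)) := by
  refine measurable_slotInput (fun i => ?_) (fun i => ?_) fun i => ?_
  · exact measurable_card_filter (f := fun k (v : SlotLabel M → ℕ) => v (.redDest k))
      (measurable_pi_apply _) (fun k => measurable_pi_apply _) i
  · exact measurable_card_filter (f := fun k (v : SlotLabel M → ℕ) => v (.greenDest k))
      (measurable_pi_apply _) (fun k => measurable_pi_apply _) i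
  · exact (measurable_of_countable fun n : ℕ => decide (n = 1)).comp (measurable_pi_apply _)

/-! ### Independence and stationarity of the slots -/

namespace Inputs

variable {Ω : Type*}

/-- The function `assemble` is the same for all slots, so measurability and equality of laws pass
from the single variables to whole slots. -/
lemma slot_eq_assemble (D : Inputs Ω M) (t : ℕ) (ω : Ω) :
    D.slot t ω = assemble fun a => D.value (a.at t) ω := by
  have h : ∀ b : Bool, b = decide (b.toNat = 1) := by decide
  simp only [slot, assemble, SlotLabel.at, value, Fin.ext_iff]
  congr 1
  funext i
  exact h _

/-- The information carried by the inputs of the slots in `S`. -/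
@[reducible] def info (D : Inputs Ω M) (S : Set ℕ) : MeasurableSpace Ω :=
  ⨆ l ∈ {l : Label M | l.time ∈ S}, MeasurableSpace.comap (D.value l) inferInstance

lemma measurable_slot_info (D : Inputs Ω M) {S : Set ℕ} {t : ℕ} (ht : t ∈ S) :
    Measurable[D.info S] (D.slot t) := by
  have h : D.slot t = assemble ∘ fun ω a => D.value (SlotLabel.at t a) ω :=
    funext fun ω => D.slot_eq_assemble t ω
  rw [h]
  refine measurable_assemble.comp (@measurable_pi_lambda _ _ _ (D.info S) _ _ fun a => ?_)
  have : MeasurableSpace.comap (D.value (a.at t)) inferInstance ≤ D.info S :=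
    le_iSup₂ (f := fun l (_ : l ∈ {l : Label M | l.time ∈ S}) =>
      MeasurableSpace.comap (D.value l) inferInstance) (a.at t)
      (by simpa [SlotLabel.time_at] using ht)
  exact measurable_iff_comap_le.2 this

lemma measurable_chain_info (D : Inputs Ω M) (x : State M) {S : Set ℕ} {t : ℕ}
    (ht : ∀ s < t, s ∈ S) : Measurable[D.info S] (D.chain x t) := by
  induction t with
  | zero => exact measurable_const
  | succ t ih =>
    have h1 := ih fun s hs => ht s (hs.trans t.lt_succ_self)
    have h2 := D.measurable_slot_info (ht t t.lt_succ_self)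
    exact (measurable_of_countable fun q : State M × SlotInput M => next q.1 q.2).comp
      (h1.prodMk h2)

variable [MeasurableSpace Ω]

namespace IsAdmissible

variable {D : Inputs Ω M} {P : Measure Ω} {p : ℝ}

lemma measurable_value (hD : D.IsAdmissible P p) (l : Label M) : Measurable (D.value l) := by
  cases l with
  | redCount t => exact hD.measurable_redCount t
  | greenCount t => exact hD.measurable_greenCount t
  | redDest t k => exact (measurable_of_countable _).comp (hD.measurable_redDest t k)
  | greenDest t k => exact (measurable_of_countable _).comp (hD.measurable_greenDest t k)
  | coin t i => exact (measurable_of_countable Bool.toNat).comp (hD.measurable_coin t i)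

lemma info_le (hD : D.IsAdmissible P p) (S : Set ℕ) : D.info S ≤ ‹MeasurableSpace Ω› :=
  iSup₂_le fun l _ => (hD.measurable_value l).comap_le

lemma measurable_slot (hD : D.IsAdmissible P p) (t : ℕ) : Measurable (D.slot t) :=
  (D.measurable_slot_info (Set.mem_univ t)).mono (hD.info_le _) le_rfl

lemma measurable_chain (hD : D.IsAdmissible P p) (x : State M) (t : ℕ) :
    Measurable (D.chain x t) :=
  (D.measurable_chain_info x (fun s _ => Set.mem_univ s)).mono (hD.info_le _) le_rfl

/-- Disjoint sets of slots use disjoint sets of labels, and disjoint subfamilies of an independent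
family generate independent σ-algebras. -/
lemma indep_info (hD : D.IsAdmissible P p) {S T : Set ℕ} (h : Disjoint S T) :
    Indep (D.info S) (D.info T) P := by
  refine indep_iSup_of_disjoint (fun l => (hD.measurable_value l).comap_le) hD.indep ?_
  exact Set.disjoint_left.2 fun l hl hl' => Set.disjoint_left.1 h hl hl'

lemma indepFun_of_info (hD : D.IsAdmissible P p) {S T : Set ℕ} (h : Disjoint S T)
    {α β : Type*} [MeasurableSpace α] [MeasurableSpace β] {f : Ω → α} {g : Ω → β}
    (hf : Measurable[D.info S] f) (hg : Measurable[D.info T] g) : IndepFun f g P := by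
  rw [IndepFun_iff_Indep]
  exact indep_of_indep_of_le_left (indep_of_indep_of_le_right (hD.indep_info h) hg.comap_le)
    hf.comap_le

lemma measure_dest_eq [IsProbabilityMeasure P] {d d' : Ω → Fin M} (hd : Measurable d)
    (hd' : Measurable d') (h : ∀ i, P {ω | d ω = i} = (M : ℝ≥0∞)⁻¹)
    (h' : ∀ i, P {ω | d' ω = i} = (M : ℝ≥0∞)⁻¹) : P.map d = P.map d' := by
  refine Measure.ext_of_singleton fun i => ?_
  rw [Measure.map_apply hd (measurableSet_singleton i),
    Measure.map_apply hd' (measurableSet_singleton i)]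
  exact (h i).trans (h' i).symm

/-- Equality of laws is assumed only for the batch sizes. For destinations and coins it follows
because their point probabilities are prescribed. -/
lemma map_value_at (hD : D.IsAdmissible P p) [IsProbabilityMeasure P] (t : ℕ)
    (a : SlotLabel M) : P.map (D.value (a.at t)) = P.map (D.value (a.at 0)) := by
  cases a with
  | redCount => exact (hD.identDistrib_redCount t).map_eq
  | greenCount => exact (hD.identDistrib_greenCount t).map_eq
  | redDest k =>
    have h := measure_dest_eq (hD.measurable_redDest t k) (hD.measurable_redDest 0 k)
      (hD.redDest_uniform t k) (hD.redDest_uniform 0 k)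
    have := congrArg (Measure.map (fun i : Fin M => (i : ℕ))) h
    rwa [Measure.map_map (measurable_of_countable _) (hD.measurable_redDest t k),
      Measure.map_map (measurable_of_countable _) (hD.measurable_redDest 0 k)] at this
  | greenDest k =>
    have h := measure_dest_eq (hD.measurable_greenDest t k) (hD.measurable_greenDest 0 k)
      (hD.greenDest_uniform t k) (hD.greenDest_uniform 0 k)
    have := congrArg (Measure.map (fun i : Fin M => (i : ℕ))) h
    rwa [Measure.map_map (measurable_of_countable _) (hD.measurable_greenDest t k),
      Measure.map_map (measurable_of_countable _) (hD.measurable_greenDest 0 k)] at this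
  | coin i =>
    have h : P.map (D.coin t i) = P.map (D.coin 0 i) := by
      have hprob : ∀ s, IsProbabilityMeasure (P.map (D.coin s i)) := fun s =>
        Measure.isProbabilityMeasure_map (hD.measurable_coin s i).aemeasurable
      have htrue : ∀ s, P.map (D.coin s i) {true} = ENNReal.ofReal p := fun s => by
        rw [Measure.map_apply (hD.measurable_coin s i) (measurableSet_singleton _)]
        exact hD.coin_bernoulli s i
      have hfalse : ∀ s, P.map (D.coin s i) {false} = 1 - ENNReal.ofReal p := fun s => by
        have := hprob s
        rw [← htrue s, ← prob_compl_eq_one_sub (measurableSet_singleton _)]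
        congr 1
        ext b; cases b <;> simp
      refine Measure.ext_of_singleton fun b => ?_
      cases b
      · rw [hfalse, hfalse]
      · rw [htrue, htrue]
    have := congrArg (Measure.map Bool.toNat) h
    rwa [Measure.map_map (measurable_of_countable _) (hD.measurable_coin t i),
      Measure.map_map (measurable_of_countable _) (hD.measurable_coin 0 i)] at this

/-- By independence the joint law of the variables of a slot is the product of the marginals, none
of which depends on the slot. -/
lemma identDistrib_slot (hD : D.IsAdmissible P p) [IsProbabilityMeasure P] (t : ℕ) :
    IdentDistrib (D.slot t) (D.slot 0) P P := by
  have hm : ∀ t, Measurable fun ω (a : SlotLabel M) => D.value (a.at t) ω := fun t =>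
    measurable_pi_lambda _ fun a => hD.measurable_value _
  have hmap : ∀ t, P.map (fun ω (a : SlotLabel M) => D.value (a.at t) ω) =
      Measure.infinitePi fun a : SlotLabel M => P.map (D.value (a.at t)) := fun t =>
    (hD.indep.precomp (SlotLabel.at_injective t)).map_fun_eq_infinitePi_map
      fun a => hD.measurable_value _
  have h : IdentDistrib (fun ω (a : SlotLabel M) => D.value (a.at t) ω)
      (fun ω (a : SlotLabel M) => D.value (a.at 0) ω) P P := by
    refine ⟨(hm t).aemeasurable, (hm 0).aemeasurable, ?_⟩
    rw [hmap, hmap]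
    simp only [hD.map_value_at t]
  have := h.comp measurable_assemble
  simpa only [Function.comp_def, ← slot_eq_assemble] using this

/-- Averaging over the input of the present slot, given the past. -/
lemma lintegral_slot (hD : D.IsAdmissible P p) [IsProbabilityMeasure P] {α : Type*}
    [MeasurableSpace α] {t : ℕ} {Z : Ω → α} (hZ : Measurable[D.info {s | s < t}] Z)
    {f : α × SlotInput M → ℝ≥0∞} (hf : Measurable f) :
    ∫⁻ ω, f (Z ω, D.slot t ω) ∂P = ∫⁻ ω, ∫⁻ ω', f (Z ω, D.slot 0 ω') ∂P ∂P := by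
  have hZ' : Measurable Z := hZ.mono (hD.info_le _) le_rfl
  have hind : IndepFun Z (D.slot t) P :=
    hD.indepFun_of_info (S := {s | s < t}) (T := {t}) (by simp) hZ
      (D.measurable_slot_info (Set.mem_singleton t))
  have hmap := (indepFun_iff_map_prod_eq_prod_map_map hZ'.aemeasurable
    (hD.measurable_slot t).aemeasurable).1 hind
  have := Measure.isProbabilityMeasure_map (μ := P) (hD.measurable_slot 0).aemeasurable
  calc ∫⁻ ω, f (Z ω, D.slot t ω) ∂P
      = ∫⁻ q, f q ∂(P.map fun ω => (Z ω, D.slot t ω)) :=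
        (lintegral_map hf (hZ'.prodMk (hD.measurable_slot t))).symm
    _ = ∫⁻ q, f q ∂((P.map Z).prod (P.map (D.slot 0))) := by
        rw [hmap, (hD.identDistrib_slot t).map_eq]
    _ = ∫⁻ z, ∫⁻ u, f (z, u) ∂(P.map (D.slot 0)) ∂(P.map Z) := lintegral_prod _ hf.aemeasurable
    _ = ∫⁻ ω, ∫⁻ u, f (Z ω, u) ∂(P.map (D.slot 0)) ∂P :=
        lintegral_map hf.lintegral_prod_right' hZ'
    _ = _ := by
        congr 1 with ω
        exact lintegral_map (hf.comp measurable_prodMk_left) (hD.measurable_slot 0)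

end IsAdmissible

end Inputs

/-! ### Transition operators and Foster's criterion -/

namespace Inputs

variable {Ω : Type*} [MeasurableSpace Ω]

/-- The transition operator of the chain. -/
noncomputable def trans (D : Inputs Ω M) (P : Measure Ω) (f : State M → ℝ≥0∞) (x : State M) :
    ℝ≥0∞ :=
  ∫⁻ ω, f (next x (D.slot 0 ω)) ∂P

/-- The transition operator of the chain that is killed when it enters `z`. -/
noncomputable def taboo (D : Inputs Ω M) (P : Measure Ω) (z : State M) (f : State M → ℝ≥0∞) :
    State M → ℝ≥0∞ :=
  D.trans P (({z}ᶜ : Set (State M)).indicator f)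

/-- The event that the chain started in `x` is not in `z` in the steps `1, …, n`. -/
def avoids (D : Inputs Ω M) (z x : State M) (n : ℕ) : Set Ω :=
  {ω | ∀ k, 1 ≤ k → k ≤ n → D.chain x k ω ≠ z}

omit [MeasurableSpace Ω] in
lemma measurableSet_avoids_info (D : Inputs Ω M) (z x : State M) (n : ℕ) :
    MeasurableSet[D.info {s | s < n}] (D.avoids z x n) := by
  have : D.avoids z x n = ⋂ k, ⋂ (_ : 1 ≤ k), ⋂ (_ : k ≤ n), D.chain x k ⁻¹' {z}ᶜ := by
    ext ω; simp [avoids]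
  rw [this]
  refine MeasurableSet.iInter fun k => MeasurableSet.iInter fun _ => MeasurableSet.iInter fun hk =>
    D.measurable_chain_info x (fun s hs => ?_) trivial
  exact lt_of_lt_of_le hs hk

section Operators

variable (D : Inputs Ω M) (P : Measure Ω) (z : State M)

lemma taboo_mono {f g : State M → ℝ≥0∞} (h : f ≤ g) : D.taboo P z f ≤ D.taboo P z g :=
  fun _ => lintegral_mono fun _ => Set.indicator_le_indicator (h _)

lemma taboo_le_trans {f g : State M → ℝ≥0∞} (h : f ≤ g) : D.taboo P z f ≤ D.trans P g :=
  fun _ => lintegral_mono fun _ => (Set.indicator_le_self _ _ _).trans (h _)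

lemma iterate_taboo_mono (n : ℕ) {f g : State M → ℝ≥0∞} (h : f ≤ g) :
    (D.taboo P z)^[n] f ≤ (D.taboo P z)^[n] g := by
  induction n generalizing f g with
  | zero => exact h
  | succ n ih => exact ih (D.taboo_mono P z h)

lemma iterate_taboo_le_trans (n : ℕ) {f g : State M → ℝ≥0∞} (h : f ≤ g) :
    (D.taboo P z)^[n] f ≤ (D.trans P)^[n] g := by
  induction n generalizing f g with
  | zero => exact h
  | succ n ih => exact ih (D.taboo_le_trans P z h)

variable {D P}

lemma IsAdmissible.taboo_add {p : ℝ} (hD : D.IsAdmissible P p) (f g : State M → ℝ≥0∞) :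
    D.taboo P z (f + g) = D.taboo P z f + D.taboo P z g := by
  funext x
  simp only [taboo, trans, Pi.add_apply, Set.indicator_add']
  refine lintegral_add_left ?_ _
  exact (measurable_of_countable fun u => ({z}ᶜ : Set (State M)).indicator f (next x u)).comp
    (hD.measurable_slot 0)

lemma IsAdmissible.taboo_const_mul {p : ℝ} (hD : D.IsAdmissible P p) (c : ℝ≥0∞)
    (f : State M → ℝ≥0∞) :
    D.taboo P z (fun x => c * f x) = fun x => c * D.taboo P z f x := by
  funext x
  unfold taboo trans
  rw [← lintegral_const_mul]
  · refine lintegral_congr fun ω => ?_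
    by_cases h : next x (D.slot 0 ω) = z <;> simp [h]
  · exact (measurable_of_countable fun u => ({z}ᶜ : Set (State M)).indicator f (next x u)).comp
      (hD.measurable_slot 0)

lemma IsAdmissible.iterate_taboo_add {p : ℝ} (hD : D.IsAdmissible P p) (n : ℕ)
    (f g : State M → ℝ≥0∞) :
    (D.taboo P z)^[n] (f + g) = (D.taboo P z)^[n] f + (D.taboo P z)^[n] g := by
  induction n generalizing f g with
  | zero => rfl
  | succ n ih => simp only [Function.iterate_succ_apply, hD.taboo_add, ih]

lemma IsAdmissible.iterate_taboo_const_mul {p : ℝ} (hD : D.IsAdmissible P p) (n : ℕ) (c : ℝ≥0∞)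
    (f : State M → ℝ≥0∞) :
    (D.taboo P z)^[n] (fun x => c * f x) = fun x => c * (D.taboo P z)^[n] f x := by
  induction n generalizing f with
  | zero => rfl
  | succ n ih => simp only [Function.iterate_succ_apply, hD.taboo_const_mul, ih]

lemma IsAdmissible.lintegral_chain {p : ℝ} (hD : D.IsAdmissible P p) [IsProbabilityMeasure P]
    (x : State M) (n : ℕ) (f : State M → ℝ≥0∞) :
    ∫⁻ ω, f (D.chain x n ω) ∂P = (D.trans P)^[n] f x := by
  induction n generalizing f with
  | zero => simp [chain]
  | succ n ih =>
    rw [Function.iterate_succ_apply, ← ih]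
    exact hD.lintegral_slot (D.measurable_chain_info x (S := {s | s < n}) fun s hs => hs)
      (f := fun q => f (next q.1 q.2)) (measurable_of_countable _)

/-- Markov property of the killed chain: powers of `taboo` compute expectations on the event that
`z` has not yet been hit. The start itself is not tested, which matches return times that begin at
step one. -/
lemma IsAdmissible.lintegral_avoids {p : ℝ} (hD : D.IsAdmissible P p) [IsProbabilityMeasure P]
    (x : State M) (n : ℕ) (f : State M → ℝ≥0∞) :
    ∫⁻ ω, (D.avoids z x n).indicator (fun ω => f (D.chain x n ω)) ω ∂P =
      (D.taboo P z)^[n] f x := by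
  induction n generalizing f with
  | zero =>
    have : D.avoids z x 0 = Set.univ := Set.eq_univ_of_forall fun ω k hk hk' => by omega
    simp [this, chain]
  | succ n ih =>
    rw [Function.iterate_succ_apply, ← ih]
    classical
    have hmem : ∀ ω, ω ∈ D.avoids z x (n + 1) ↔
        ω ∈ D.avoids z x n ∧ D.chain x (n + 1) ω ≠ z := by
      refine fun ω => ⟨fun h => ⟨fun k hk hk' => h k hk (by omega), h _ (by omega) le_rfl⟩, ?_⟩
      rintro ⟨h1, h2⟩ k hk hk'
      rcases Nat.lt_or_ge k (n + 1) with h | h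
      · exact h1 k hk (by omega)
      · obtain rfl : k = n + 1 := by omega
        exact h2
    -- The relevant past is coded as a countable-valued variable: a flag for having avoided `z` so
    -- far, together with the present state.
    have hZ : Measurable[D.info {s | s < n}]
        fun ω => (decide (ω ∈ D.avoids z x n), D.chain x n ω) := by
      refine Measurable.prodMk ?_
        (D.measurable_chain_info x (S := {s | s < n}) fun s hs => hs)
      exact @measurable_to_bool _ (D.info {s | s < n}) _ (by
        simpa [Set.preimage] using D.measurableSet_avoids_info z x n)
    have key := hD.lintegral_slot hZ (f := fun q : (Bool × State M) × SlotInput M =>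
      if q.1.1 then ({z}ᶜ : Set (State M)).indicator f (next q.1.2 q.2) else 0)
      (measurable_of_countable _)
    convert key using 3 with ω ω
    · simp only [Set.indicator_apply, hmem, decide_eq_true_eq, Set.mem_compl_iff,
        Set.mem_singleton_iff, ← ite_and]
      rfl
    · by_cases h : ω ∈ D.avoids z x n
      · simp [h, taboo, trans]
      · simp [h]

end Operators

/-- The mean of `min τ n`, where `τ` is the return time to `z`. -/
noncomputable def truncMean (D : Inputs Ω M) (P : Measure Ω) (z : State M) (n : ℕ) :
    State M → ℝ≥0∞ :=
  ∑ k ∈ Finset.range n, (D.taboo P z)^[k] 1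

variable {D : Inputs Ω M} {P : Measure Ω} {p : ℝ}

lemma IsAdmissible.iterate_taboo_one (hD : D.IsAdmissible P p) [IsProbabilityMeasure P]
    (z x : State M) (n : ℕ) : (D.taboo P z)^[n] 1 x = P (D.avoids z x n) := by
  rw [← hD.lintegral_avoids z x n, ← lintegral_indicator_one
    (hD.info_le _ _ (D.measurableSet_avoids_info z x n))]
  rfl

lemma IsAdmissible.truncMean_le (hD : D.IsAdmissible P p) [IsProbabilityMeasure P]
    (z x : State M) (n : ℕ) : D.truncMean P z n x ≤ n := by
  simp only [truncMean, Finset.sum_apply]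
  calc _ ≤ ∑ k ∈ Finset.range n, (1 : ℝ≥0∞) :=
        Finset.sum_le_sum fun k _ => (hD.iterate_taboo_one z x k).trans_le prob_le_one
    _ = n := by simp

/-- Restart at time `m`: what `min τ (m + n)` has beyond `min τ m` is a fresh truncated return time,
counted only if `z` was avoided up to `m`. -/
lemma IsAdmissible.truncMean_add (hD : D.IsAdmissible P p) (z x : State M) (n m : ℕ) :
    D.truncMean P z (m + n) x =
      D.truncMean P z m x + (D.taboo P z)^[m] (D.truncMean P z n) x := by
  have h : (D.taboo P z)^[m] (D.truncMean P z n) =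
      ∑ k ∈ Finset.range n, (D.taboo P z)^[m + k] 1 := by
    induction n with
    | zero =>
      have := hD.iterate_taboo_const_mul z m 0 0
      rw [truncMean, Finset.sum_range_zero, Finset.sum_range_zero]
      simp only [Pi.zero_apply, zero_mul] at this
      exact this
    | succ n ih =>
      rw [truncMean, Finset.sum_range_succ, hD.iterate_taboo_add, Finset.sum_range_succ, ← ih,
        Function.iterate_add_apply, truncMean]
  rw [h, ← Pi.add_apply, truncMean, truncMean, Finset.sum_range_add]

omit [MeasurableSpace Ω] in
-- The tail-sum formula `τ = ∑ 1{τ > n}`; upper bounds on mean return times need only this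
-- inequality.
lemma returnTime_le_tsum (D : Inputs Ω M) (z x : State M) (ω : Ω) :
    D.returnTime {z} x ω ≤ ∑' n, (D.avoids z x n).indicator 1 ω := by
  classical
  by_cases h : ∃ t, 1 ≤ t ∧ D.chain x t ω = z
  · have hs := Nat.find_spec h
    calc D.returnTime {z} x ω ≤ ((Nat.find h : ℕ) : ℝ≥0∞) :=
          iInf₂_le (f := fun (t : ℕ) (_ : 1 ≤ t ∧ D.chain x t ω ∈ ({z} : Set (State M))) =>
            (t : ℝ≥0∞)) (Nat.find h) hs
      _ = ∑ n ∈ Finset.range (Nat.find h), (D.avoids z x n).indicator 1 ω := by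
        rw [Finset.sum_congr rfl (g := fun _ => (1 : ℝ≥0∞)) fun n hn => ?_]
        · simp
        · refine Set.indicator_of_mem (fun k hk hk' hz => ?_) 1
          exact Nat.find_min h (lt_of_le_of_lt hk' (Finset.mem_range.1 hn)) ⟨hk, hz⟩
      _ ≤ _ := ENNReal.sum_le_tsum _
  · push Not at h
    have : ∀ n, (D.avoids z x n).indicator (1 : Ω → ℝ≥0∞) ω = 1 := fun n =>
      Set.indicator_of_mem (s := D.avoids z x n) (fun k hk _ => h k hk) 1
    simp [this]

lemma IsAdmissible.measurable_returnTime (hD : D.IsAdmissible P p) (V : Set (State M))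
    (x : State M) : Measurable (D.returnTime V x) := by
  classical
  have : D.returnTime V x =
      fun ω => ⨅ t : ℕ, if 1 ≤ t ∧ D.chain x t ω ∈ V then (t : ℝ≥0∞) else ⊤ := by
    funext ω
    simp only [returnTime, iInf_eq_if]
  rw [this]
  refine Measurable.iInf fun t => Measurable.ite ?_ measurable_const measurable_const
  exact (MeasurableSet.const _).inter (hD.measurable_chain x t (MeasurableSet.of_discrete (s := V)))

lemma IsAdmissible.lintegral_returnTime_le (hD : D.IsAdmissible P p) [IsProbabilityMeasure P]
    {z x : State M} {b : ℝ≥0∞} (h : ∀ n, D.truncMean P z n x ≤ b) :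
    ∫⁻ ω, D.returnTime {z} x ω ∂P ≤ b := by
  have hm : ∀ n, MeasurableSet (D.avoids z x n) := fun n =>
    hD.info_le _ _ (D.measurableSet_avoids_info z x n)
  calc ∫⁻ ω, D.returnTime {z} x ω ∂P
      ≤ ∫⁻ ω, ∑' n, (D.avoids z x n).indicator 1 ω ∂P :=
        lintegral_mono fun ω => D.returnTime_le_tsum z x ω
    _ = ∑' n, (D.taboo P z)^[n] 1 x := by
        rw [lintegral_tsum fun n => (measurable_one.indicator (hm n)).aemeasurable]
        congr 1 with n
        rw [lintegral_indicator_one (hm n), hD.iterate_taboo_one]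
    _ ≤ b := ENNReal.tsum_le_of_sum_range_le fun n => by
        simpa [truncMean] using h n

/-- Excursions of mean cost `C`, repeated with probability `q`, cost `C / (1 - q)` in total. Adding
`m` keeps the inequality, since `q * m ≤ m`. -/
lemma exists_renewal_bound {q C : ℝ≥0∞} (hq : q < 1) (hC : C < ∞) (m : ℕ) :
    ∃ b : ℝ≥0∞, b < ∞ ∧ (m : ℝ≥0∞) ≤ b ∧ C + q * b ≤ b := by
  lift q to NNReal using hq.ne_top
  lift C to NNReal using hC.ne
  have hq' : (q : ℝ) < 1 := by exact_mod_cast hq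
  have hq0 : (0 : ℝ) < 1 - q := by linarith
  refine ⟨((m + C / (1 - q) : NNReal) : ℝ≥0∞), ENNReal.coe_lt_top, ?_, ?_⟩
  · exact_mod_cast le_self_add
  · norm_cast
    rw [← NNReal.coe_le_coe]
    push_cast [NNReal.coe_sub (show q ≤ 1 by exact_mod_cast hq.le)]
    have h : (C : ℝ) + q * (C / (1 - q)) = C / (1 - q) := by field_simp; ring
    have h2 : (q : ℝ) * m ≤ m := by nlinarith [q.coe_nonneg, Nat.cast_nonneg (α := ℝ) m]
    nlinarith

/-- Foster's criterion: if a Lyapunov function decreases on average over a fixed number of steps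
outside a finite set, and the state `z` is accessible from every state, then `z` is positive
recurrent. -/
theorem IsAdmissible.positiveRecurrentSet_of_drift (hD : D.IsAdmissible P p)
    [IsProbabilityMeasure P] (z : State M) (V : State M → ℕ) (K m : ℕ) (hm : 1 ≤ m)
    (hfin : {x | V x ≤ K}.Finite)
    (hint : ∀ x n, ∫⁻ ω, (V (D.chain x n ω) : ℝ≥0∞) ∂P < ∞)
    (hdrift : ∀ x, K < V x → ∫⁻ ω, (V (D.chain x m ω) : ℝ≥0∞) ∂P + 1 ≤ V x)
    (hreach : ∀ x, ∃ n, 1 ≤ n ∧ 0 < P {ω | D.chain x n ω = z}) :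
    D.PositiveRecurrentSet P {z} := by
  choose n hn1 hn using hreach
  -- One horizon for all states of the finite set: from each of them `z` is hit within `N` steps
  -- with probability at least `1 - q`, where `q < 1`.
  set N : ℕ := hfin.toFinset.sup n + 1 with hN
  set q : ℝ≥0∞ := hfin.toFinset.sup fun x => (D.taboo P z)^[N] 1 x with hq_def
  have hq : q < 1 := by
    refine (Finset.sup_lt_iff (by simp)).2 fun x hx => ?_
    have hle : n x ≤ N := (Finset.le_sup hx).trans (Nat.le_succ _)
    have hmeas : MeasurableSet {ω | D.chain x (n x) ω = z} :=
      hD.measurable_chain x (n x) (measurableSet_singleton z)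
    rw [hD.iterate_taboo_one]
    calc P (D.avoids z x N) ≤ P {ω | D.chain x (n x) ω = z}ᶜ :=
          measure_mono fun ω hω => hω _ (hn1 x) hle
      _ = 1 - P {ω | D.chain x (n x) ω = z} := prob_compl_eq_one_sub hmeas
      _ < 1 := ENNReal.sub_lt_self ENNReal.one_ne_top one_ne_zero (hn x).ne'
  set v : State M → ℝ≥0∞ := fun x => (V x : ℝ≥0∞) with hv
  set C : ℝ≥0∞ := hfin.toFinset.sup fun x => N + m * (D.trans P)^[N] v x with hC_def
  have hC : C < ∞ := by
    refine (Finset.sup_lt_iff (by simp)).2 fun x _ => ?_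
    rw [← hD.lintegral_chain]
    exact ENNReal.add_lt_top.2 ⟨ENNReal.natCast_lt_top _,
      ENNReal.mul_lt_top (ENNReal.natCast_lt_top _) (hint x N)⟩
  obtain ⟨b, hb, hbm, hbC⟩ := exists_renewal_bound hq hC (N + m)
  -- The bound is uniform in the truncation `k`, which makes all quantities in the induction finite.
  -- For large `k`, restart after `m` steps outside the finite set and after `N` steps inside it.
  have key : ∀ k x, D.truncMean P z k x ≤ m * v x + b := by
    intro k
    induction k using Nat.strong_induction_on with
    | _ k ih =>
    intro x
    rcases Nat.lt_or_ge k (N + m) with hk | hk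
    · calc D.truncMean P z k x ≤ k := hD.truncMean_le z x k
        _ ≤ (N + m : ℕ) := by exact_mod_cast hk.le
        _ ≤ b := hbm
        _ ≤ _ := le_add_self
    have hstep : ∀ l, 1 ≤ l → l ≤ k → D.truncMean P z k x ≤
        l + (m * (D.taboo P z)^[l] v x + b * (D.taboo P z)^[l] 1 x) := by
      intro l hl hlk
      obtain ⟨j, rfl⟩ := Nat.exists_eq_add_of_le hlk
      rw [hD.truncMean_add]
      refine add_le_add (hD.truncMean_le z x l) ?_
      calc (D.taboo P z)^[l] (D.truncMean P z j) x
          ≤ (D.taboo P z)^[l] ((fun y => m * v y) + fun y => b * (1 : State M → ℝ≥0∞) y) x := by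
            refine D.iterate_taboo_mono P z l (fun y => ?_) x
            simpa using ih j (by omega) y
        _ = _ := by
            rw [hD.iterate_taboo_add, hD.iterate_taboo_const_mul, hD.iterate_taboo_const_mul]
            rfl
    have htr : ∀ l, (D.taboo P z)^[l] v x ≤ (D.trans P)^[l] v x := fun l =>
      D.iterate_taboo_le_trans P z l le_rfl x
    rcases Nat.lt_or_ge K (V x) with hx | hx
    -- The factor `m` in front of `v` makes one unit of drift pay for the `m` elapsed steps.
    · calc D.truncMean P z k x ≤ _ := hstep m hm (by omega)
        _ ≤ m + (m * (D.trans P)^[m] v x + b * 1) := by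
            gcongr
            · exact htr m
            · rw [hD.iterate_taboo_one]; exact prob_le_one
        _ = m * (∫⁻ ω, (V (D.chain x m ω) : ℝ≥0∞) ∂P + 1) + b := by
            rw [hD.lintegral_chain x m v]; ring
        _ ≤ m * v x + b := by gcongr; exact hdrift x hx
    -- Here there is no drift, but the constant `b` is multiplied by the probability `q` of still
    -- missing `z`, and `b` was chosen to absorb `C`.
    · have hxF : x ∈ hfin.toFinset := by simpa using hx
      calc D.truncMean P z k x ≤ _ := hstep N (by omega) (by omega)
        _ ≤ N + (m * (D.trans P)^[N] v x + b * q) := by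
            gcongr
            · exact htr N
            · exact Finset.le_sup (f := fun x => (D.taboo P z)^[N] 1 x) hxF
        _ = (N + m * (D.trans P)^[N] v x) + q * b := by ring
        _ ≤ C + q * b := by
            gcongr
            exact Finset.le_sup (f := fun x => N + m * (D.trans P)^[N] v x) hxF
        _ ≤ b := hbC
        _ ≤ _ := le_add_self
  have hmean : ∀ x, ∫⁻ ω, D.returnTime {z} x ω ∂P < ∞ := fun x =>
    (hD.lintegral_returnTime_le fun k => key k x).trans_lt <|
      ENNReal.add_lt_top.2 ⟨ENNReal.mul_lt_top (ENNReal.natCast_lt_top _)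
        (ENNReal.natCast_lt_top _), hb⟩
  exact ⟨fun x => ae_lt_top (hD.measurable_returnTime _ x) (hmean x).ne, by simpa using hmean z⟩

end Inputs

/-! ### Reaching the empty state under favourable inputs -/

/-- The number of slots until it is the turn of station `i`, if it is now the turn of `c`. -/
def wait (i c : Fin M) : ℕ :=
  if (c : ℕ) ≤ i then i - c else i + M - c

lemma nextStation_val (c : Fin M) :
    (nextStation c : ℕ) = if (c : ℕ) + 1 < M then (c : ℕ) + 1 else 0 := by
  have := c.isLt
  simp only [nextStation]
  split_ifs with h
  · exact Nat.mod_eq_of_lt h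
  · rw [show (c : ℕ) + 1 = M by omega, Nat.mod_self]

lemma wait_lt (i c : Fin M) : wait i c < M := by
  have := c.isLt; have := i.isLt
  unfold wait; split_ifs <;> omega

lemma wait_self (i : Fin M) : wait i i = 0 := by simp [wait]

lemma wait_nextStation_self (i : Fin M) : wait i (nextStation i) + 1 = M := by
  have := i.isLt
  unfold wait; rw [nextStation_val]; split_ifs <;> omega

lemma wait_nextStation_of_ne {i c : Fin M} (h : c ≠ i) : wait i (nextStation c) + 1 = wait i c := by
  have := c.isLt; have := i.isLt
  have : (c : ℕ) ≠ i := fun h' => h (Fin.ext h')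
  unfold wait; rw [nextStation_val]; split_ifs <;> omega

/-- The input of a slot in which `k` red messages arrive, all of them at station `i`. -/
def feed (k : ℕ) (i : Fin M) (c : Fin M → Bool) : SlotInput M :=
  ⟨Pi.single i k, 0, c⟩

/-- The input of a slot without arrivals. -/
def noArrivals (c : Fin M → Bool) : SlotInput M :=
  ⟨0, 0, c⟩

lemma green_next_le (x : State M) {u : SlotInput M} (hu : u.greenIn = 0) (i : Fin M) :
    (next x u).green i ≤ x.green i := by
  simp only [next, hu, Pi.zero_apply]
  split_ifs <;> omega

lemma green_next_lt {x : State M} {u : SlotInput M} (hu : u.greenIn = 0) {i : Fin M}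
    (hi : SendsGreen x u i) : (next x u).green i < x.green i := by
  have := hi.1.1
  simp only [next, hu, Pi.zero_apply, if_pos hi]
  omega

lemma red_next_le (x : State M) {u : SlotInput M} (hu : u.redIn = 0) (i : Fin M) :
    (next x u).red i ≤ x.red i := by
  simp only [next, hu, Pi.zero_apply]
  split_ifs <;> omega

/-- The coins `C` allow every station with a green message to transmit it alone. -/
def Separable (C : Set (Fin M → Bool)) (x : State M) : Prop :=
  ∀ j, 0 < x.green j → ∃ c ∈ C, c j = true ∧ ∀ i, i ≠ j → 0 < x.green i → c i = false

lemma Separable.next {C : Set (Fin M → Bool)} {x : State M} (h : Separable C x)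
    {u : SlotInput M} (hu : u.greenIn = 0) : Separable C (next x u) := by
  intro j hj
  obtain ⟨c, hc, h1, h2⟩ := h j (hj.trans_le (green_next_le x hu j))
  exact ⟨c, hc, h1, fun i hi hg => h2 i hi (hg.trans_le (green_next_le x hu i))⟩

section Reach

variable {C : Set (Fin M → Bool)} (hC : C.Nonempty) {H : State M → Prop}
  (hH : ∀ x, ∀ c ∈ C, H (next x (noArrivals c)) → H x) {z : State M} (hz : H z)
  (hzr : z.red = 0) (hzg : z.green = 0)

include hC hH hz hzr hzg

/-- In this section `H` stands for accessibility of `z`; only its closure under backward steps is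
used, so the argument is purely combinatorial. An empty network idles until the turn agrees with
that of `z`. -/
lemma reach_of_empty (x : State M) (hr : x.red = 0) (hg : x.green = 0) : H x := by
  obtain ⟨c, hc⟩ := hC
  induction hd : wait z.turn x.turn generalizing x with
  | zero =>
    have ht : x.turn = z.turn := by
      by_contra h
      have := wait_nextStation_of_ne h
      omega
    rwa [State.ext ht (hr.trans hzr.symm) (hg.trans hzg.symm)]
  | succ d ih =>
    have ht : x.turn ≠ z.turn := by
      intro h
      rw [h, wait_self] at hd
      omega
    refine hH x c hc (ih _ ?_ ?_ ?_)
    · funext i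
      simpa [hr] using red_next_le x (u := noArrivals c) rfl i
    · funext i
      simpa [hg] using green_next_le x (u := noArrivals c) rfl i
    · have := wait_nextStation_of_ne ht
      simp only [next]
      omega

/-- Without red messages, a coin pattern that isolates one non-empty station lowers the total green
content by at least one message. -/
lemma reach_of_red_empty (x : State M) (hr : x.red = 0) (hx : Separable C x) : H x := by
  induction hs : ∑ i, x.green i using Nat.strong_induction_on generalizing x with
  | _ s ih =>
  by_cases hg : x.green = 0
  · exact reach_of_empty hC hH hz hzr hzg x hr hg
  · obtain ⟨j, hj⟩ := Function.ne_iff.1 hg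
    have hj' : 0 < x.green j := Nat.pos_of_ne_zero hj
    obtain ⟨c, hc, h1, h2⟩ := hx j hj'
    have hsend : SendsGreen x (noArrivals c) j := by
      refine ⟨⟨hj', by simp [hr], h1⟩, fun i hi hi' => ?_⟩
      exact Bool.false_ne_true ((h2 i hi hi'.1).symm.trans hi'.2.2)
    refine hH x c hc (ih _ ?_ _ ?_ (hx.next rfl) rfl)
    · rw [← hs]
      exact Finset.sum_lt_sum (fun i _ => green_next_le x rfl i)
        ⟨j, Finset.mem_univ j, green_next_lt rfl hsend⟩
    · funext i
      simpa [hr] using red_next_le x (u := noArrivals c) rfl i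

/-- Red messages leave regardless of the coins: induct on their total number and, for a fixed total,
on the waiting time until the turn of a station with a non-empty red queue. -/
lemma reach_of_separable (x : State M) (hx : Separable C x) : H x := by
  obtain ⟨c, hc⟩ := id hC
  induction hs : ∑ i, x.red i using Nat.strong_induction_on generalizing x with
  | _ s ih =>
  by_cases hr : x.red = 0
  · exact reach_of_red_empty hC hH hz hzr hzg x hr hx
  · obtain ⟨i, hi⟩ := Function.ne_iff.1 hr
    have hi' : 0 < x.red i := Nat.pos_of_ne_zero hi
    clear hi hr
    induction hd : wait i x.turn generalizing x with
    | zero =>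
      have ht : x.turn = i := by
        by_contra h
        have := wait_nextStation_of_ne h
        omega
      refine hH x c hc (ih _ ?_ _ (hx.next rfl) rfl)
      rw [← hs]
      refine Finset.sum_lt_sum (fun i _ => red_next_le x rfl i) ⟨i, Finset.mem_univ i, ?_⟩
      have : SendsRed x i := ⟨ht.symm, hi'⟩
      simp only [next, if_pos this, noArrivals, Pi.zero_apply]
      omega
    | succ d ih' =>
      have ht : x.turn ≠ i := by
        intro h
        rw [h, wait_self] at hd
        omega
      have hle : ∑ j, (next x (noArrivals c)).red j ≤ s :=
        hs ▸ Finset.sum_le_sum fun i _ => red_next_le x rfl i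
      rcases hle.lt_or_eq with hlt | heq
      · exact hH x c hc (ih _ hlt _ (hx.next rfl) rfl)
      · refine hH x c hc (ih' _ (hx.next rfl) heq ?_ ?_)
        · have : ¬ SendsRed x i := fun h => ht h.1.symm
          simp only [next, if_neg this, noArrivals, Pi.zero_apply]
          omega
        · have := wait_nextStation_of_ne ht
          simp only [next]
          omega

end Reach

/-- When all coins show `true`, two stations with green messages collide unless one of them sends
red. Feeding red messages to station `0` in every slot keeps it busy at each of its turns, and then
station `1` transmits alone. Once station `1` has no green message, the state is separable. -/
lemma reach_of_two_stations {C : Set (Fin 2 → Bool)} (hC : (fun _ => true) ∈ C)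
    {H : State 2 → Prop} (hH : ∀ x, ∀ c ∈ C, H (next x (noArrivals c)) → H x) {z : State 2}
    (hz : H z) (hzr : z.red = 0) (hzg : z.green = 0) {k : ℕ} (hk : 1 ≤ k)
    (hfeed : ∀ x, H (next x (feed k 0 fun _ => true)) → H x) (x : State 2) : H x := by
  have hred : ∀ x : State 2, 0 < (next x (feed k 0 fun _ => true)).red 0 := fun x => by
    simp only [next, feed, Pi.single_eq_same]
    omega
  have main : ∀ x : State 2, 0 < x.red 0 → H x := by
    intro x hx
    induction hs : x.green 1 using Nat.strong_induction_on generalizing x with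
    | _ s ih =>
    rcases Nat.eq_zero_or_pos s with h0 | h0
    · refine reach_of_separable ⟨_, hC⟩ hH hz hzr hzg x fun j hj => ⟨_, hC, rfl, fun i hi hg => ?_⟩
      have h1 : ∀ i, 0 < x.green i → i = 0 := fun i hi => by
        by_contra h
        have : i = 1 := by omega
        subst this
        omega
      exact absurd ((h1 i hg).trans (h1 j hj).symm) hi
    · induction hd : wait 0 x.turn generalizing x with
      | zero =>
        have ht : x.turn = 0 := by
          by_contra h
          have := wait_nextStation_of_ne h
          omega
        refine hfeed x (ih _ ?_ _ (hred x) rfl)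
        rw [← hs]
        refine green_next_lt rfl ⟨⟨by omega, ?_, rfl⟩, fun j hj hj' => ?_⟩
        · intro h
          have := h.1
          omega
        · have : j = 0 := by omega
          subst this
          exact hj'.2.1 ⟨ht.symm, hx⟩
      | succ d ih' =>
        have ht : x.turn ≠ 0 := by
          intro h
          rw [h, wait_self] at hd
          omega
        have hle : (next x (feed k 0 fun _ => true)).green 1 ≤ s :=
          hs ▸ green_next_le x rfl 1
        rcases hle.lt_or_eq with hlt | heq
        · exact hfeed x (ih _ hlt _ (hred x) rfl)
        · refine hfeed x (ih' _ (hred x) heq ?_)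
          have := wait_nextStation_of_ne ht
          simp only [next]
          omega
  exact hfeed x (main _ (hred x))

namespace Inputs

variable {Ω : Type*} [MeasurableSpace Ω] {D : Inputs Ω M} {P : Measure Ω} {p : ℝ}

/-- Finitely many independent variables force this input: the two counts, the first `k` red
destinations and the coins. -/
lemma IsAdmissible.measure_slot_feed_pos (hD : D.IsAdmissible P p) (k : ℕ) (i : Fin M)
    (c : Fin M → Bool) (hk : 0 < P {ω | D.redCount 0 ω = k})
    (h0 : 0 < P {ω | D.greenCount 0 ω = 0}) (hc : ∀ j, 0 < P {ω | D.coin 0 j ω = c j}) :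
    0 < P {ω | D.slot 0 ω = feed k i c} := by
  classical
  -- The value at `greenDest` is a dummy: no green message arrives, and these labels do not belong
  -- to `S`.
  let v : Label M → ℕ
    | .redCount _ => k
    | .greenCount _ => 0
    | .redDest _ _ => i
    | .greenDest _ _ => 0
    | .coin _ j => (c j).toNat
  let S : Set (Label M) := {l | l = .redCount 0 ∨ l = .greenCount 0 ∨
    (∃ n < k, l = .redDest 0 n) ∨ ∃ j, l = .coin 0 j}
  have hS : S.Finite := by
    have : S ⊆ {.redCount 0} ∪ ({.greenCount 0} ∪
        (((fun n => Label.redDest 0 n) '' Set.Iio k) ∪ Set.range fun j => Label.coin 0 j)) := by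
      rintro l (h | h | ⟨n, hn, h⟩ | ⟨j, h⟩) <;> simp [h]
      exact hn
    refine Set.Finite.subset ?_ this
    exact (Set.finite_singleton _).union ((Set.finite_singleton _).union
      (((Set.finite_Iio k).image _).union (Set.finite_range _)))
  have hpos : 0 < P (⋂ l ∈ hS.toFinset, D.value l ⁻¹' {v l}) := by
    rw [hD.indep.meas_biInter fun l _ => ⟨_, measurableSet_singleton _, rfl⟩]
    refine pos_iff_ne_zero.2 (Finset.prod_ne_zero_iff.2 fun l hl => pos_iff_ne_zero.1 ?_)
    rw [Set.Finite.mem_toFinset] at hl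
    rcases hl with rfl | rfl | ⟨n, hn, rfl⟩ | ⟨j, rfl⟩
    · exact hk
    · exact h0
    · have h := hD.redDest_uniform 0 n i
      have h2 : D.value (.redDest 0 n) ⁻¹' {v (.redDest 0 n)} = {ω | D.redDest 0 n ω = i} := by
        ext ω; simp [value, v, Fin.ext_iff]
      rw [h2, h]
      simp
    · have h2 : D.value (.coin 0 j) ⁻¹' {v (.coin 0 j)} = {ω | D.coin 0 j ω = c j} := by
        ext ω; cases h : D.coin 0 j ω <;> cases h' : c j <;> simp [value, v, h, h']
      rw [h2]
      exact hc j
  refine hpos.trans_le (measure_mono fun ω hω => ?_)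
  have hω : ∀ l ∈ S, D.value l ω = v l := by simpa using hω
  have h1 : D.redCount 0 ω = k := hω (.redCount 0) (by simp [S])
  have h2 : D.greenCount 0 ω = 0 := hω (.greenCount 0) (by simp [S])
  have h3 : ∀ n < k, D.redDest 0 n ω = i := fun n hn =>
    Fin.ext (hω (.redDest 0 n) (by simp [S, hn]))
  have h4 : ∀ j, D.coin 0 j ω = c j := fun j => by
    have := hω (.coin 0 j) (by simp [S])
    revert this
    cases h : D.coin 0 j ω <;> cases h' : c j <;> simp [value, v, h, h']
  simp only [Set.mem_ofPred_eq, slot, feed, SlotInput.mk.injEq, h1, h2]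
  refine ⟨?_, by ext; simp, funext h4⟩
  funext j
  by_cases hj : j = i
  · subst hj
    rw [Pi.single_eq_same, Finset.filter_true_of_mem fun n hn => h3 n (Finset.mem_range.1 hn),
      Finset.card_range]
  · rw [Pi.single_eq_of_ne hj, Finset.card_eq_zero, Finset.filter_eq_empty_iff]
    exact fun n hn h => hj (h.symm.trans (h3 n (Finset.mem_range.1 hn)))

lemma feed_zero (i : Fin M) (c : Fin M → Bool) : feed 0 i c = noArrivals c := by
  simp [feed, noArrivals]

lemma IsAdmissible.trans_pos (hD : D.IsAdmissible P p) {f : State M → ℝ≥0∞} {x : State M}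
    {u : SlotInput M} (hu : 0 < P {ω | D.slot 0 ω = u}) (hf : 0 < f (next x u)) :
    0 < D.trans P f x := by
  have hm : MeasurableSet {ω | D.slot 0 ω = u} :=
    hD.measurable_slot 0 (measurableSet_singleton u)
  calc 0 < f (next x u) * P {ω | D.slot 0 ω = u} := ENNReal.mul_pos hf.ne' hu.ne'
    _ = ∫⁻ ω in {ω | D.slot 0 ω = u}, f (next x u) ∂P := by rw [setLIntegral_const]
    _ = ∫⁻ ω in {ω | D.slot 0 ω = u}, f (next x (D.slot 0 ω)) ∂P :=
        setLIntegral_congr_fun hm fun ω (hω : D.slot 0 ω = u) => by simp only [hω]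
    _ ≤ D.trans P f x := setLIntegral_le_lintegral _ _

/-- The chain reaches `z` from `x` with positive probability. -/
def Accessible (D : Inputs Ω M) (P : Measure Ω) (z x : State M) : Prop :=
  ∃ n, 0 < (D.trans P)^[n] (({z} : Set (State M)).indicator 1) x

lemma IsAdmissible.accessible_of_next (hD : D.IsAdmissible P p) {z x : State M}
    {u : SlotInput M} (hu : 0 < P {ω | D.slot 0 ω = u}) (h : D.Accessible P z (next x u)) :
    D.Accessible P z x := by
  obtain ⟨n, hn⟩ := h
  refine ⟨n + 1, ?_⟩
  rw [Function.iterate_succ_apply']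
  exact hD.trans_pos hu hn

lemma IsAdmissible.exists_measure_chain_pos (hD : D.IsAdmissible P p) [IsProbabilityMeasure P]
    {z : State M} (h : ∀ x, D.Accessible P z x) {u : SlotInput M}
    (hu : 0 < P {ω | D.slot 0 ω = u}) (x : State M) :
    ∃ n, 1 ≤ n ∧ 0 < P {ω | D.chain x n ω = z} := by
  obtain ⟨n, hn⟩ := h (next x u)
  refine ⟨n + 1, by omega, ?_⟩
  have hm : MeasurableSet {ω | D.chain x (n + 1) ω = z} :=
    hD.measurable_chain x (n + 1) (measurableSet_singleton z)
  have h1 := hD.lintegral_chain x (n + 1) (({z} : Set (State M)).indicator 1)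
  rw [Function.iterate_succ_apply'] at h1
  rw [← lintegral_indicator_one hm]
  have h2 := hD.trans_pos hu hn
  rw [← h1] at h2
  exact h2

/-- The empty state with turn `0` is accessible from every state. -/
theorem IsAdmissible.exists_accessible (hD : D.IsAdmissible P p) [IsProbabilityMeasure P]
    (hM : 1 ≤ M) (hp0 : 0 < p) (h0 : 0 < P {ω | D.redCount 0 ω = 0})
    (h0' : 0 < P {ω | D.greenCount 0 ω = 0})
    (h1 : p < 1 ∨ M = 1 ∨ (M = 2 ∧ ∃ k, 1 ≤ k ∧ 0 < P {ω | D.redCount 0 ω = k})) :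
    ∃ z : State M, ∀ x, ∃ n, 1 ≤ n ∧ 0 < P {ω | D.chain x n ω = z} := by
  have htrue : ∀ j, 0 < P {ω | D.coin 0 j ω = true} := fun j => by
    rw [hD.coin_bernoulli]; simpa using hp0
  have hfalse : p < 1 → ∀ j, 0 < P {ω | D.coin 0 j ω = false} := fun hp j => by
    have : {ω | D.coin 0 j ω = false} = {ω | D.coin 0 j ω = true}ᶜ := by ext; simp
    have hm : MeasurableSet {ω | D.coin 0 j ω = true} :=
      hD.measurable_coin 0 j (measurableSet_singleton true)
    rw [this, prob_compl_eq_one_sub hm, hD.coin_bernoulli]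
    simpa using hp
  let i₀ : Fin M := ⟨0, hM⟩
  let C : Set (Fin M → Bool) := {c | ∀ j, 0 < P {ω | D.coin 0 j ω = c j}}
  have hC : (fun _ => true) ∈ C := htrue
  have hslot : ∀ c ∈ C, 0 < P {ω | D.slot 0 ω = noArrivals c} := fun c hc => by
    rw [← feed_zero i₀]
    exact hD.measure_slot_feed_pos 0 i₀ c h0 h0' hc
  let z : State M := ⟨i₀, 0, 0⟩
  refine ⟨z, fun x => hD.exists_measure_chain_pos (fun x => ?_) (hslot _ hC) x⟩
  have hH : ∀ x, ∀ c ∈ C, D.Accessible P z (next x (noArrivals c)) → D.Accessible P z x :=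
    fun x c hc h => hD.accessible_of_next (hslot c hc) h
  have hz : D.Accessible P z z := ⟨0, by simp⟩
  -- For `p < 1` every coin pattern has positive probability, in particular the one in which only
  -- `j` tries. A single station has no competitor. Two stations with `p = 1` need red traffic.
  rcases h1 with hp | hM1 | ⟨hM2, k, hk, hk'⟩
  · refine reach_of_separable ⟨_, hC⟩ hH hz rfl rfl x fun j _ =>
      ⟨fun i => decide (i = j), fun i => ?_, by simp, fun i hi _ => by simpa using hi⟩
    by_cases hi : i = j
    · simpa [hi] using htrue j
    · simpa [hi] using hfalse hp i
  · refine reach_of_separable ⟨_, hC⟩ hH hz rfl rfl x fun j _ =>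
      ⟨_, hC, rfl, fun i hi _ => absurd (Fin.ext ?_) hi⟩
    have := i.isLt; have := j.isLt
    omega
  · subst hM2
    exact reach_of_two_stations hC hH hz rfl rfl hk (fun x h => hD.accessible_of_next
      (hD.measure_slot_feed_pos k 0 _ hk' h0' htrue) h) x

end Inputs

/-! ### Arrivals at single stations and laws of large numbers -/

lemma lintegral_card_filter {Ω : Type*} [MeasurableSpace Ω] {P : Measure Ω} {N : Ω → ℕ}
    {d : ℕ → Ω → ℕ} (hN : Measurable N) (hd : ∀ k, Measurable (d k))
    (hind : ∀ k, IndepFun N (d k) P) {i : ℕ} {c : ℝ≥0∞} (hc : ∀ k, P {ω | d k ω = i} = c) :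
    ∫⁻ ω, (((Finset.range (N ω)).filter fun k => d k ω = i).card : ℝ≥0∞) ∂P =
      c * ∫⁻ ω, (N ω : ℝ≥0∞) ∂P := by
  have hA : ∀ k, MeasurableSet {ω | k < N ω} := fun k => hN (MeasurableSet.of_discrete (s := Set.Ioi k))
  have hB : ∀ k, MeasurableSet {ω | d k ω = i} := fun k => hd k (measurableSet_singleton i)
  -- Wald's identity: the count is the sum of `1{k < N} 1{d k = i}` over all `k`, and each summand
  -- is a product of independent indicators.
  have h1 : ∀ ω, (((Finset.range (N ω)).filter fun k => d k ω = i).card : ℝ≥0∞) =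
      ∑' k, ({ω | k < N ω} ∩ {ω | d k ω = i}).indicator 1 ω := by
    intro ω
    rw [tsum_eq_sum (s := (Finset.range (N ω)).filter fun k => d k ω = i)]
    · rw [Finset.card_eq_sum_ones, Nat.cast_sum]
      refine Finset.sum_congr rfl fun k hk => ?_
      rw [Finset.mem_filter, Finset.mem_range] at hk
      rw [Set.indicator_of_mem (s := {ω | k < N ω} ∩ {ω | d k ω = i}) hk]
      simp
    · intro k hk
      rw [Finset.mem_filter, Finset.mem_range] at hk
      exact Set.indicator_of_notMem (s := {ω | k < N ω} ∩ {ω | d k ω = i}) hk _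
  have h2 : ∀ ω, (N ω : ℝ≥0∞) = ∑' k, ({ω | k < N ω}).indicator 1 ω := by
    intro ω
    rw [tsum_eq_sum (s := Finset.range (N ω))]
    · rw [Finset.sum_congr rfl (g := fun _ => (1 : ℝ≥0∞))]
      · simp
      · intro k hk
        exact Set.indicator_of_mem (s := {ω | k < N ω}) (Finset.mem_range.1 hk) _
    · intro k hk
      exact Set.indicator_of_notMem (s := {ω | k < N ω}) (fun h => hk (Finset.mem_range.2 h)) _
  simp_rw [h1, h2]
  rw [lintegral_tsum fun k => (measurable_one.indicator ((hA k).inter (hB k))).aemeasurable,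
    lintegral_tsum fun k => (measurable_one.indicator (hA k)).aemeasurable, ← ENNReal.tsum_mul_left]
  congr 1 with k
  rw [lintegral_indicator_one ((hA k).inter (hB k)), lintegral_indicator_one (hA k), ← hc k, mul_comm]
  exact (hind k).measure_inter_preimage_eq_mul (Set.Ioi k) {i} MeasurableSet.of_discrete
    MeasurableSet.of_discrete

lemma integrable_and_integral_of_lintegral {Ω : Type*} [MeasurableSpace Ω] {P : Measure Ω}
    {X N : Ω → ℕ} (hX : Measurable X) (hN : Measurable N)
    (hint : Integrable (fun ω => (N ω : ℝ)) P)
    (h : ∫⁻ ω, (X ω : ℝ≥0∞) ∂P = (M : ℝ≥0∞)⁻¹ * ∫⁻ ω, (N ω : ℝ≥0∞) ∂P) (hM : 1 ≤ M) :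
    Integrable (fun ω => (X ω : ℝ)) P ∧ ∫ ω, (X ω : ℝ) ∂P = (∫ ω, (N ω : ℝ) ∂P) / M := by
  have hX' : Measurable fun ω => (X ω : ℝ) := (measurable_of_countable _).comp hX
  have hN' : Measurable fun ω => (N ω : ℝ) := (measurable_of_countable _).comp hN
  have hfin : ∫⁻ ω, (N ω : ℝ≥0∞) ∂P < ∞ := by
    have := hint.2
    simpa [HasFiniteIntegral, enorm_eq_nnnorm] using this
  have e : ∀ Y : Ω → ℕ, Measurable (fun ω => (Y ω : ℝ)) →
      ∫ ω, (Y ω : ℝ) ∂P = (∫⁻ ω, (Y ω : ℝ≥0∞) ∂P).toReal := fun Y hY => by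
    rw [integral_eq_lintegral_of_nonneg_ae (.of_forall fun ω => Nat.cast_nonneg _)
      hY.aestronglyMeasurable]
    simp
  refine ⟨⟨hX'.aestronglyMeasurable, ?_⟩, ?_⟩
  · have : ∫⁻ ω, (X ω : ℝ≥0∞) ∂P < ∞ := by
      rw [h]
      exact ENNReal.mul_lt_top (by simp; omega) hfin
    simpa [HasFiniteIntegral, enorm_eq_nnnorm] using this
  · rw [e X hX', e N hN', h, ENNReal.toReal_mul]
    simp [div_eq_inv_mul]

namespace Inputs

variable {Ω : Type*} [MeasurableSpace Ω] {D : Inputs Ω M} {P : Measure Ω} {p : ℝ}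

namespace IsAdmissible

variable (hD : D.IsAdmissible P p) [IsProbabilityMeasure P]

include hD

omit [IsProbabilityMeasure P] in
lemma integrable_redIn (hM : 1 ≤ M) (i : Fin M) :
    Integrable (fun ω => ((D.slot 0 ω).redIn i : ℝ)) P ∧
      ∫ ω, ((D.slot 0 ω).redIn i : ℝ) ∂P = (∫ ω, (D.redCount 0 ω : ℝ) ∂P) / M := by
  refine integrable_and_integral_of_lintegral ((measurable_of_countable fun u : SlotInput M =>
    u.redIn i).comp (hD.measurable_slot 0)) (hD.measurable_redCount 0) hD.integrable_redCount ?_ hM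
  rw [← lintegral_card_filter (d := fun k => D.value (.redDest 0 k)) (i := i)
    (hD.measurable_redCount 0) (fun k => hD.measurable_value _)
    (fun k => hD.indep.indepFun (i := .redCount 0) (by simp)) fun k => ?_]
  · simp only [slot, value, Fin.ext_iff]
    congr!
  · simpa [value, Fin.ext_iff] using hD.redDest_uniform 0 k i

omit [IsProbabilityMeasure P] in
lemma integrable_greenIn (hM : 1 ≤ M) (i : Fin M) :
    Integrable (fun ω => ((D.slot 0 ω).greenIn i : ℝ)) P ∧
      ∫ ω, ((D.slot 0 ω).greenIn i : ℝ) ∂P = (∫ ω, (D.greenCount 0 ω : ℝ) ∂P) / M := by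
  refine integrable_and_integral_of_lintegral ((measurable_of_countable fun u : SlotInput M =>
    u.greenIn i).comp (hD.measurable_slot 0)) (hD.measurable_greenCount 0)
    hD.integrable_greenCount ?_ hM
  rw [← lintegral_card_filter (d := fun k => D.value (.greenDest 0 k)) (i := i)
    (hD.measurable_greenCount 0) (fun k => hD.measurable_value _)
    (fun k => hD.indep.indepFun (i := .greenCount 0) (by simp)) fun k => ?_]
  · simp only [slot, value, Fin.ext_iff]
    congr!
  · simpa [value, Fin.ext_iff] using hD.greenDest_uniform 0 k i

omit [IsProbabilityMeasure P] in
lemma pairwise_indepFun_slot (φ : SlotInput M → ℝ) :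
    Pairwise (Function.onFun (IndepFun · · P) fun t ω => φ (D.slot t ω)) := by
  intro s t hst
  have := hD.indepFun_of_info (S := {s}) (T := {t}) (by simpa using hst)
    (D.measurable_slot_info (Set.mem_singleton s)) (D.measurable_slot_info (Set.mem_singleton t))
  exact this.comp (measurable_of_countable φ) (measurable_of_countable φ)

lemma identDistrib_comp_slot (φ : SlotInput M → ℝ) (t : ℕ) :
    IdentDistrib (fun ω => φ (D.slot t ω)) (fun ω => φ (D.slot 0 ω)) P P :=
  (hD.identDistrib_slot t).comp (measurable_of_countable φ)

lemma ae_tendsto_average (φ : SlotInput M → ℝ) (hφ : Integrable (fun ω => φ (D.slot 0 ω)) P) :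
    ∀ᵐ ω ∂P, Tendsto (fun n : ℕ => (∑ t ∈ Finset.range n, φ (D.slot t ω)) / n) atTop
      (𝓝 (∫ ω, φ (D.slot 0 ω) ∂P)) :=
  strong_law_ae_real (fun t ω => φ (D.slot t ω)) hφ (hD.pairwise_indepFun_slot φ)
    (hD.identDistrib_comp_slot φ)

lemma integrable_sum_slot (φ : SlotInput M → ℝ) (hφ : Integrable (fun ω => φ (D.slot 0 ω)) P)
    (n : ℕ) : Integrable (fun ω => ∑ t ∈ Finset.range n, φ (D.slot t ω)) P :=
  integrable_finsetSum _ fun t _ => (hD.identDistrib_comp_slot φ t).integrable_iff.2 hφ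

/-- The drift condition concerns means, so convergence in `L¹` is needed besides almost sure
convergence. -/
lemma tendsto_integral_abs_average (φ : SlotInput M → ℝ)
    (hφ : Integrable (fun ω => φ (D.slot 0 ω)) P) :
    Tendsto (fun n : ℕ => (∫ ω, |∑ t ∈ Finset.range n, φ (D.slot t ω) -
      n * ∫ ω, φ (D.slot 0 ω) ∂P| ∂P) / n) atTop (𝓝 0) := by
  have h := strong_law_Lp le_rfl ENNReal.one_ne_top (fun t ω => φ (D.slot t ω))
    (memLp_one_iff_integrable.2 hφ) (hD.pairwise_indepFun_slot φ) (hD.identDistrib_comp_slot φ)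
  have h2 := (ENNReal.tendsto_toReal ENNReal.zero_ne_top).comp h
  refine h2.congr' ?_
  filter_upwards [eventually_gt_atTop 0] with n hn
  have hn' : (0 : ℝ) < n := by exact_mod_cast hn
  have hint : Integrable (fun ω => (n : ℝ)⁻¹ • ∑ t ∈ Finset.range n, φ (D.slot t ω) -
      ∫ ω, φ (D.slot 0 ω) ∂P) P :=
    ((hD.integrable_sum_slot φ hφ n).const_mul _).sub (integrable_const _)
  simp only [Function.comp_apply]
  rw [eLpNorm_one_eq_lintegral_enorm, ← integral_norm_eq_lintegral_enorm hint.1, div_eq_inv_mul,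
    ← integral_const_mul]
  congr 1 with ω
  rw [Real.norm_eq_abs, ← abs_of_pos (inv_pos.2 hn'), ← abs_mul, abs_of_pos (inv_pos.2 hn')]
  congr 1
  rw [smul_eq_mul, mul_sub, inv_mul_cancel_left₀ hn'.ne']

end IsAdmissible

end Inputs

/-- The affine form of `f t = o(t)` holds for all `t` at once, small ones included. It can therefore
be used at a time `s ≤ t` about which nothing else is known. -/
lemma tendsto_div_natCast_zero_iff (f : ℕ → ℝ) :
    Tendsto (fun t : ℕ => f t / t) atTop (𝓝 0) ↔ ∀ ε > 0, ∃ K, ∀ t : ℕ, |f t| ≤ ε * t + K := by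
  constructor
  · intro h ε hε
    obtain ⟨n, hn⟩ := eventually_atTop.1 (Metric.tendsto_nhds.1 h ε hε)
    refine ⟨∑ t ∈ Finset.range (n + 1), |f t|, fun t => ?_⟩
    have hK : 0 ≤ ∑ t ∈ Finset.range (n + 1), |f t| := Finset.sum_nonneg fun _ _ => abs_nonneg _
    rcases Nat.lt_or_ge t (n + 1) with ht | ht
    · have := Finset.single_le_sum (f := fun t => |f t|) (fun _ _ => abs_nonneg _)
        (Finset.mem_range.2 ht)
      have : 0 ≤ ε * t := by positivity
      linarith
    · have ht0 : (0 : ℝ) < t := by exact_mod_cast (by omega : 0 < t)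
      have := hn t (by omega)
      rw [Real.dist_eq, sub_zero, abs_div, abs_of_pos ht0, div_lt_iff₀ ht0] at this
      linarith
  · intro h
    refine Metric.tendsto_atTop.2 fun ε hε => ?_
    obtain ⟨K, hK⟩ := h (ε / 2) (by positivity)
    obtain ⟨n, hn⟩ := exists_nat_gt (2 * K / ε)
    refine ⟨n + 1, fun t ht => ?_⟩
    have ht0 : (0 : ℝ) < t := by exact_mod_cast (by omega : 0 < t)
    have hnt : (n : ℝ) ≤ t := by exact_mod_cast (by omega : n ≤ t)
    rw [Real.dist_eq, sub_zero, abs_div, abs_of_pos ht0, div_lt_iff₀ ht0]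
    have h1 := hK t
    have h2 : 2 * K < ε * t := by
      rw [div_lt_iff₀ hε] at hn
      nlinarith
    linarith

/-! ### Growth of the red queues -/

/-- The state without messages in which it is the turn of station `c`. -/
def emptyState (c : Fin M) : State M := ⟨c, 0, 0⟩

namespace Inputs

variable {Ω : Type*} (D : Inputs Ω M)

/-- The number of red messages that arrive at station `i` before slot `t`. -/
noncomputable def redArrivals (i : Fin M) (t : ℕ) (ω : Ω) : ℝ :=
  ∑ s ∈ Finset.range t, ((D.slot s ω).redIn i : ℝ)

/-- The number of green messages that arrive at station `i` before slot `t`. -/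
noncomputable def greenArrivals (i : Fin M) (t : ℕ) (ω : Ω) : ℝ :=
  ∑ s ∈ Finset.range t, ((D.slot s ω).greenIn i : ℝ)

/-- The length of the red queue of station `i`. -/
noncomputable def redQueue (x : State M) (i : Fin M) (t : ℕ) (ω : Ω) : ℝ :=
  ((D.chain x t ω).red i : ℝ)

variable {D}

lemma chain_congr_red {x y : State M} (ht : x.turn = y.turn) (hr : x.red = y.red) (t : ℕ) (ω : Ω) :
    (D.chain x t ω).turn = (D.chain y t ω).turn ∧ (D.chain x t ω).red = (D.chain y t ω).red := by
  induction t with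
  | zero => exact ⟨ht, hr⟩
  | succ t ih => simp [chain, next, SendsRed, ih.1, ih.2]

lemma chain_turn_congr {x y : State M} (ht : x.turn = y.turn) (t : ℕ) (ω : Ω) :
    (D.chain x t ω).turn = (D.chain y t ω).turn := by
  induction t with
  | zero => exact ht
  | succ t ih => simp [chain, next, ih]

lemma redArrivals_succ (i : Fin M) (t : ℕ) (ω : Ω) :
    D.redArrivals i (t + 1) ω = D.redArrivals i t ω + (D.slot t ω).redIn i :=
  Finset.sum_range_succ _ _

lemma redArrivals_nonneg (i : Fin M) (t : ℕ) (ω : Ω) : 0 ≤ D.redArrivals i t ω :=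
  Finset.sum_nonneg fun _ _ => Nat.cast_nonneg _

lemma redQueue_nonneg (x : State M) (i : Fin M) (t : ℕ) (ω : Ω) : 0 ≤ D.redQueue x i t ω :=
  Nat.cast_nonneg _

/-- One step of a red queue, with the visits of the turn expressed by waiting times. -/
lemma redQueue_succ (x : State M) (i : Fin M) (t : ℕ) (ω : Ω) :
    D.redQueue x i (t + 1) ω = (D.slot t ω).redIn i +
      max 0 (D.redQueue x i t ω - if i = (D.chain x t ω).turn then 1 else 0) := by
  simp only [redQueue, chain, next, SendsRed]
  by_cases hi : i = (D.chain x t ω).turn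
  · rw [if_pos hi]
    rcases Nat.eq_zero_or_pos ((D.chain x t ω).red i) with h | h
    · simp [h]
    · rw [if_pos ⟨hi, h⟩]
      have : (1 : ℝ) ≤ (D.chain x t ω).red i := by exact_mod_cast h
      push_cast [Nat.cast_sub (show 1 ≤ (D.chain x t ω).red i from h)]
      rw [max_eq_right (by linarith)]
      ring
  · rw [if_neg hi, if_neg fun h => hi h.1]
    push_cast
    rw [sub_zero, max_eq_right (Nat.cast_nonneg _)]
    ring

/-- The waiting time jumps from `0` to `M - 1` at a visit and drops by one otherwise. So the visits
have frequency `1 / M` up to a telescoping error bounded by one. -/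
lemma mul_turn_eq (x : State M) (i : Fin M) (t : ℕ) (ω : Ω) :
    (M : ℝ) * (if i = (D.chain x t ω).turn then 1 else 0) =
      1 + wait i (D.chain x (t + 1) ω).turn - wait i (D.chain x t ω).turn := by
  simp only [chain, next]
  split_ifs with h
  · rw [← h, wait_self]
    have := wait_nextStation_self i
    rw [mul_one]
    have : (wait i (nextStation i) : ℝ) + 1 = M := by exact_mod_cast this
    rw [Nat.cast_zero]
    linarith
  · have h' := wait_nextStation_of_ne (i := i) (c := (D.chain x t ω).turn) fun h' => h h'.symm
    have : ((wait i (nextStation (D.chain x t ω).turn) : ℝ)) + 1 = wait i (D.chain x t ω).turn := by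
      exact_mod_cast h'
    linarith

lemma turn_eq_div (hM : 1 ≤ M) (x : State M) (i : Fin M) (t : ℕ) (ω : Ω) :
    (if i = (D.chain x t ω).turn then (1 : ℝ) else 0) =
      1 / M + wait i (D.chain x (t + 1) ω).turn / M - wait i (D.chain x t ω).turn / M := by
  have hM0 : (0 : ℝ) < M := by exact_mod_cast hM
  have := D.mul_turn_eq x i t ω
  rw [← add_div, ← sub_div, ← this]
  field_simp

lemma wait_div_mem (hM : 1 ≤ M) (i c : Fin M) :
    0 ≤ (wait i c : ℝ) / M ∧ (wait i c : ℝ) / M ≤ 1 := by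
  have hM0 : (0 : ℝ) < M := by exact_mod_cast hM
  refine ⟨by positivity, ?_⟩
  rw [div_le_one hM0]
  exact_mod_cast (wait_lt i c).le

/-- As long as no offered service is wasted, the queue is given by the linear balance. After the
first wasted service it is dominated by the queue that started empty. -/
lemma redQueue_le_max (hM : 1 ≤ M) (x : State M) (i : Fin M) (t : ℕ) (ω : Ω) :
    D.redQueue x i t ω ≤ max (x.red i + D.redArrivals i t ω - t / M + 1)
      (D.redQueue (emptyState x.turn) i t ω) := by
  have key : D.redQueue x i t ω ≤ max (x.red i + D.redArrivals i t ω -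
      (t / M + wait i (D.chain x t ω).turn / M - wait i x.turn / M))
      (D.redQueue (emptyState x.turn) i t ω) := by
    induction t with
    | zero =>
      refine le_max_of_le_left ?_
      simp [redQueue, redArrivals, chain]
    | succ t ih =>
      have hturn : (D.chain (emptyState x.turn) t ω).turn = (D.chain x t ω).turn :=
        D.chain_turn_congr (x := emptyState x.turn) (y := x) rfl t ω
      have h0 := D.redQueue_nonneg (emptyState x.turn) i t ω
      rw [redQueue_succ, redQueue_succ, hturn, redArrivals_succ, turn_eq_div hM]
      push_cast
      rw [add_div]
      set w := (wait i (D.chain x t ω).turn : ℝ) / M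
      set w' := (wait i (D.chain x (t + 1) ω).turn : ℝ) / M
      set e := D.redQueue (emptyState x.turn) i t ω
      have hmax := le_max_right 0 (e - (1 / M + w' - w))
      have hmax0 := le_max_left 0 (e - (1 / M + w' - w))
      rcases le_max_iff.1 ih with h | h
      · rcases le_total 0 (D.redQueue x i t ω - (1 / M + w' - w)) with h' | h'
        · rw [max_eq_right h']
          refine le_max_of_le_left ?_
          linarith
        · rw [max_eq_left h']
          exact le_max_of_le_right (by linarith)
      · refine le_max_of_le_right ?_
        gcongr
  refine key.trans (max_le_max_right _ ?_)
  have h1 := wait_div_mem hM i (D.chain x t ω).turn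
  have h2 := wait_div_mem hM i x.turn
  linarith

lemma redQueue_le_add (x : State M) (i : Fin M) (t : ℕ) (ω : Ω) :
    D.redQueue x i t ω ≤ x.red i + D.redQueue (emptyState x.turn) i t ω := by
  induction t with
  | zero => simp [redQueue, chain]
  | succ t ih =>
    have hturn : (D.chain (emptyState x.turn) t ω).turn = (D.chain x t ω).turn :=
      D.chain_turn_congr (x := emptyState x.turn) (y := x) rfl t ω
    rw [redQueue_succ, redQueue_succ, hturn]
    set e := D.redQueue (emptyState x.turn) i t ω
    set a : ℝ := if i = (D.chain x t ω).turn then 1 else 0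
    have h1 := le_max_left 0 (e - a)
    have h2 := le_max_right 0 (e - a)
    have h3 : (0 : ℝ) ≤ x.red i := Nat.cast_nonneg _
    have : max 0 (D.redQueue x i t ω - a) ≤ x.red i + max 0 (e - a) :=
      max_le (by linarith) (by linarith)
    linarith

lemma redQueue_empty_le_arrivals (c i : Fin M) (t : ℕ) (ω : Ω) :
    D.redQueue (emptyState c) i t ω ≤ D.redArrivals i t ω := by
  induction t with
  | zero => simp [redQueue, chain, redArrivals, emptyState]
  | succ t ih =>
    rw [redQueue_succ, redArrivals_succ]
    have h0 := D.redArrivals_nonneg i t ω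
    have : max 0 (D.redQueue (emptyState c) i t ω -
        if i = (D.chain (emptyState c) t ω).turn then 1 else 0) ≤ D.redArrivals i t ω :=
      max_le h0 (by split_ifs <;> linarith)
    linarith

/-- Since the last wasted service, at time `s`, every offered service was used. One unit of the
constant covers the visit at `s`, the other the difference of waiting times. -/
lemma exists_redQueue_empty_le (hM : 1 ≤ M) (c i : Fin M) (t : ℕ) (ω : Ω) :
    ∃ s ≤ t, D.redQueue (emptyState c) i t ω ≤
      D.redArrivals i t ω - D.redArrivals i s ω - ((t : ℝ) - s) / M + 2 := by
  have key : ∃ s ≤ t, D.redQueue (emptyState c) i t ω ≤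
      D.redArrivals i t ω - D.redArrivals i s ω - (((t : ℝ) - s) / M +
        wait i (D.chain (emptyState c) t ω).turn / M -
        wait i (D.chain (emptyState c) s ω).turn / M) + 1 := by
    induction t with
    | zero => exact ⟨0, le_rfl, by simp [redQueue, chain, emptyState]⟩
    | succ t ih =>
      obtain ⟨s, hs, h⟩ := ih
      have hstep := D.redQueue_succ (emptyState c) i t ω
      rcases le_total 0 (D.redQueue (emptyState c) i t ω -
        if i = (D.chain (emptyState c) t ω).turn then 1 else 0) with h' | h'
      · refine ⟨s, by omega, ?_⟩
        rw [max_eq_right h', turn_eq_div hM] at hstep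
        rw [hstep, redArrivals_succ]
        push_cast
        rw [sub_div] at h
        rw [sub_div, add_div]
        linarith
      · refine ⟨t, by omega, ?_⟩
        rw [max_eq_left h'] at hstep
        rw [hstep, redArrivals_succ]
        have h2 := D.turn_eq_div hM (emptyState c) i t ω
        have h3 : (if i = (D.chain (emptyState c) t ω).turn then (1 : ℝ) else 0) ≤ 1 := by
          split_ifs <;> norm_num
        push_cast
        rw [show (t : ℝ) + 1 - t = 1 by ring]
        linarith
  obtain ⟨s, hs, h⟩ := key
  refine ⟨s, hs, ?_⟩
  have h1 := wait_div_mem hM i (D.chain (emptyState c) t ω).turn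
  have h2 := wait_div_mem hM i (D.chain (emptyState c) s ω).turn
  linarith

/-- The number of red messages transmitted by a station. -/
lemma sum_sendsRed (x : State M) (i : Fin M) (t : ℕ) (ω : Ω) :
    ∑ s ∈ Finset.range t, (if SendsRed (D.chain x s ω) i then (1 : ℝ) else 0) =
      x.red i + D.redArrivals i t ω - D.redQueue x i t ω := by
  induction t with
  | zero => simp [redQueue, chain, redArrivals]
  | succ t ih =>
    rw [Finset.sum_range_succ, ih, redArrivals_succ]
    simp only [redQueue, chain, next]
    split_ifs with h
    · push_cast [Nat.cast_sub (show 1 ≤ (D.chain x t ω).red i from h.2)]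
      ring
    · push_cast
      ring

variable [MeasurableSpace Ω] {P : Measure Ω} {p : ℝ}

namespace IsAdmissible

variable (hD : D.IsAdmissible P p) [IsProbabilityMeasure P]

include hD

lemma ae_tendsto_redArrivals (hM : 1 ≤ M) (i : Fin M) :
    ∀ᵐ ω ∂P, Tendsto (fun t : ℕ => D.redArrivals i t ω / t) atTop
      (𝓝 ((∫ ω, (D.redCount 0 ω : ℝ) ∂P) / M)) := by
  have h := hD.integrable_redIn hM i
  rw [← h.2]
  exact hD.ae_tendsto_average (fun u => (u.redIn i : ℝ)) h.1

lemma ae_tendsto_greenArrivals (hM : 1 ≤ M) (i : Fin M) :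
    ∀ᵐ ω ∂P, Tendsto (fun t : ℕ => D.greenArrivals i t ω / t) atTop
      (𝓝 ((∫ ω, (D.greenCount 0 ω : ℝ) ∂P) / M)) := by
  have h := hD.integrable_greenIn hM i
  rw [← h.2]
  exact hD.ae_tendsto_average (fun u => (u.greenIn i : ℝ)) h.1

lemma tendsto_integral_redArrivals (hM : 1 ≤ M) (i : Fin M) :
    Tendsto (fun t : ℕ => (∫ ω, |D.redArrivals i t ω -
      t * ((∫ ω, (D.redCount 0 ω : ℝ) ∂P) / M)| ∂P) / t) atTop (𝓝 0) := by
  have h := hD.integrable_redIn hM i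
  rw [← h.2]
  exact hD.tendsto_integral_abs_average (fun u => (u.redIn i : ℝ)) h.1

lemma tendsto_integral_greenArrivals (hM : 1 ≤ M) (i : Fin M) :
    Tendsto (fun t : ℕ => (∫ ω, |D.greenArrivals i t ω -
      t * ((∫ ω, (D.greenCount 0 ω : ℝ) ∂P) / M)| ∂P) / t) atTop (𝓝 0) := by
  have h := hD.integrable_greenIn hM i
  rw [← h.2]
  exact hD.tendsto_integral_abs_average (fun u => (u.greenIn i : ℝ)) h.1

lemma integrable_redArrivals (hM : 1 ≤ M) (i : Fin M) (t : ℕ) :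
    Integrable (D.redArrivals i t) P :=
  hD.integrable_sum_slot (fun u => (u.redIn i : ℝ)) (hD.integrable_redIn hM i).1 t

lemma integrable_greenArrivals (hM : 1 ≤ M) (i : Fin M) (t : ℕ) :
    Integrable (D.greenArrivals i t) P :=
  hD.integrable_sum_slot (fun u => (u.greenIn i : ℝ)) (hD.integrable_greenIn hM i).1 t

omit [IsProbabilityMeasure P] in
lemma measurable_redQueue (x : State M) (i : Fin M) (t : ℕ) : Measurable (D.redQueue x i t) :=
  (measurable_of_countable fun y : State M => (y.red i : ℝ)).comp (hD.measurable_chain x t)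

lemma integrable_redQueue_empty (hM : 1 ≤ M) (c i : Fin M) (t : ℕ) :
    Integrable (D.redQueue (emptyState c) i t) P := by
  refine (hD.integrable_redArrivals hM i t).mono'
    (hD.measurable_redQueue _ i t).aestronglyMeasurable (.of_forall fun ω => ?_)
  rw [Real.norm_eq_abs, abs_of_nonneg (D.redQueue_nonneg _ i t ω)]
  exact D.redQueue_empty_le_arrivals c i t ω

/-- Arrivals between `s` and `t` are `a * (t - s)` up to `o(t)`, uniformly in `s ≤ t`, and the
offered services `(t - s) / M` compensate for the main term because `a ≤ 1 / M`. -/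
lemma ae_tendsto_redQueue_empty (hM : 1 ≤ M) (hR : ∫ ω, (D.redCount 0 ω : ℝ) ∂P < 1)
    (c i : Fin M) :
    ∀ᵐ ω ∂P, Tendsto (fun t : ℕ => D.redQueue (emptyState c) i t ω / t) atTop (𝓝 0) := by
  have hM0 : (0 : ℝ) < M := by exact_mod_cast hM
  filter_upwards [hD.ae_tendsto_redArrivals hM i] with ω hω
  set a := (∫ ω, (D.redCount 0 ω : ℝ) ∂P) / M with ha
  have haM : a ≤ 1 / M := by rw [ha]; gcongr
  have h0 : Tendsto (fun t : ℕ => (D.redArrivals i t ω - a * t) / t) atTop (𝓝 0) := by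
    have := hω.sub_const a
    rw [sub_self] at this
    refine this.congr' ?_
    filter_upwards [eventually_gt_atTop 0] with t ht
    have : (0 : ℝ) < t := by exact_mod_cast ht
    field_simp
  rw [tendsto_div_natCast_zero_iff] at h0 ⊢
  intro ε hε
  obtain ⟨K, hK⟩ := h0 (ε / 2) (by positivity)
  refine ⟨2 * K + 2, fun t => ?_⟩
  rw [abs_of_nonneg (D.redQueue_nonneg _ i t ω)]
  obtain ⟨s, hs, h⟩ := D.exists_redQueue_empty_le hM c i t ω
  have h1 := (abs_le.1 (hK t)).2
  have h2 := (abs_le.1 (hK s)).1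
  have hst : (s : ℝ) ≤ t := by exact_mod_cast hs
  have h3 : a * (t - s) ≤ (t - s) / M := by
    rw [div_eq_mul_one_div, mul_comm]
    exact mul_le_mul_of_nonneg_left haM (by linarith)
  nlinarith

/-- The queue is at most the arrivals `A`, so `Q / t ≤ |A - t a| / t + min (Q / t) a`. The first
term vanishes in mean by the `L¹` law of large numbers, the second by dominated convergence. -/
lemma tendsto_integral_redQueue_empty (hM : 1 ≤ M) (hR : ∫ ω, (D.redCount 0 ω : ℝ) ∂P < 1)
    (c i : Fin M) :
    Tendsto (fun t : ℕ => (∫ ω, D.redQueue (emptyState c) i t ω ∂P) / t) atTop (𝓝 0) := by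
  set a := (∫ ω, (D.redCount 0 ω : ℝ) ∂P) / M with ha
  have ha0 : 0 ≤ a := div_nonneg (integral_nonneg fun _ => Nat.cast_nonneg _) (Nat.cast_nonneg _)
  have hmin : Tendsto (fun t : ℕ => ∫ ω, min (D.redQueue (emptyState c) i t ω / t) a ∂P) atTop
      (𝓝 (∫ _, (0 : ℝ) ∂P)) := by
    refine tendsto_integral_of_dominated_convergence (fun _ => a) (fun t => ?_)
      (integrable_const _) (fun t => .of_forall fun ω => ?_) ?_
    · exact (((hD.measurable_redQueue _ i t).div_const _).min measurable_const).aestronglyMeasurable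
    · have : 0 ≤ D.redQueue (emptyState c) i t ω / t :=
        div_nonneg (D.redQueue_nonneg _ i t ω) (Nat.cast_nonneg _)
      rw [Real.norm_eq_abs, abs_of_nonneg (le_min this ha0)]
      exact min_le_right _ _
    · filter_upwards [hD.ae_tendsto_redQueue_empty hM hR c i] with ω hω
      simpa [ha0] using hω.min (tendsto_const_nhds (x := a))
  have hsum := (hD.tendsto_integral_redArrivals hM i).add hmin
  rw [integral_zero, add_zero] at hsum
  refine tendsto_of_tendsto_of_tendsto_of_le_of_le' tendsto_const_nhds hsum
    (.of_forall fun t => div_nonneg (integral_nonneg fun ω => D.redQueue_nonneg _ i t ω)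
      (Nat.cast_nonneg _)) ?_
  filter_upwards [eventually_gt_atTop 0] with t ht
  have ht0 : (0 : ℝ) < t := by exact_mod_cast ht
  have hi1 : Integrable (fun ω => |D.redArrivals i t ω - t * a| / t) P :=
    (((hD.integrable_redArrivals hM i t).sub (integrable_const _)).abs).div_const _
  have hi2 := hD.integrable_redQueue_empty hM c i t
  have hi3 : Integrable (fun ω => min (D.redQueue (emptyState c) i t ω / t) a) P := by
    refine (hi2.div_const t).mono' (((hD.measurable_redQueue _ i t).div_const _).min
      measurable_const).aestronglyMeasurable (.of_forall fun ω => ?_)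
    have : 0 ≤ D.redQueue (emptyState c) i t ω / t :=
      div_nonneg (D.redQueue_nonneg _ i t ω) (Nat.cast_nonneg _)
    rw [Real.norm_eq_abs, abs_of_nonneg (le_min this ha0)]
    exact min_le_left _ _
  rw [← integral_div, ← integral_div, ← integral_add hi1 hi3]
  refine integral_mono (hi2.div_const _) (hi1.add hi3) fun ω => ?_
  have hA := D.redQueue_empty_le_arrivals c i t ω
  have habs := le_abs_self (D.redArrivals i t ω - t * a)
  have hnn : 0 ≤ |D.redArrivals i t ω - t * a| / t := by positivity
  rcases le_total (D.redQueue (emptyState c) i t ω / t) a with h | h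
  · rw [min_eq_left h]; linarith
  · rw [min_eq_right h, ← sub_le_iff_le_add, div_sub' ht0.ne', div_le_div_iff_of_pos_right ht0]
    linarith

end IsAdmissible

end Inputs

/-! ### Service in the saturated network -/

open scoped Classical in
/-- The indicator of a successful green transmission of station `j` in the saturated network, in
which all stations always have green messages. -/
noncomputable def saturated (x : State M) (c : Fin M → Bool) (j : Fin M) : ℝ :=
  if ¬ SendsRed x j ∧ c j = true ∧ ∀ i, i ≠ j → ¬ SendsRed x i → c i = false then 1 else 0

/-- The probability of a successful green transmission of station `j` in the saturated network. -/
noncomputable def rate (p : ℝ) (x : State M) (j : Fin M) : ℝ :=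
  p * (1 - p) ^ (M - 1) +
    (p * (1 - p) ^ (M - 2) - p * (1 - p) ^ (M - 1)) *
      (∑ i ∈ Finset.univ.erase j, if SendsRed x i then 1 else 0) -
    p * (1 - p) ^ (M - 1) * if SendsRed x j then 1 else 0

lemma saturated_nonneg (x : State M) (c : Fin M → Bool) (j : Fin M) : 0 ≤ saturated x c j := by
  unfold saturated; split_ifs <;> norm_num

lemma saturated_le_one (x : State M) (c : Fin M → Bool) (j : Fin M) : saturated x c j ≤ 1 := by
  unfold saturated; split_ifs <;> norm_num

lemma abs_le_of_abs_sub_le {f : ℕ → ℝ} (h : ∀ n, |f (n + 1) - f n| ≤ 1) (n k : ℕ) :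
    |f (n + k)| ≤ |f n| + k := by
  induction k with
  | zero => simp
  | succ k ih =>
    have := h (n + k)
    have h2 := abs_sub_abs_le_abs_sub (f (n + k + 1)) (f (n + k))
    rw [← add_assoc]
    push_cast
    linarith

/-- An integer `n` lies within `2 √n` of the preceding square `k ^ 2`, and `f` changes by at most
one per step. -/
lemma tendsto_div_of_tendsto_div_sq {f : ℕ → ℝ} (h : ∀ n, |f (n + 1) - f n| ≤ 1)
    (hsq : Tendsto (fun k : ℕ => f (k ^ 2) / (k : ℝ) ^ 2) atTop (𝓝 0)) :
    Tendsto (fun n : ℕ => f n / n) atTop (𝓝 0) := by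
  rw [tendsto_div_natCast_zero_iff]
  intro ε hε
  have hsq' : ∃ K, ∀ k : ℕ, |f (k ^ 2)| ≤ ε / 2 * (k : ℝ) ^ 2 + K := by
    obtain ⟨n, hn⟩ := eventually_atTop.1 (Metric.tendsto_nhds.1 hsq (ε / 2) (by positivity))
    refine ⟨∑ k ∈ Finset.range (n + 1), |f (k ^ 2)|, fun k => ?_⟩
    have hK : 0 ≤ ∑ k ∈ Finset.range (n + 1), |f (k ^ 2)| :=
      Finset.sum_nonneg fun _ _ => abs_nonneg _
    rcases Nat.lt_or_ge k (n + 1) with hk | hk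
    · have := Finset.single_le_sum (f := fun k => |f (k ^ 2)|) (fun _ _ => abs_nonneg _)
        (Finset.mem_range.2 hk)
      have : 0 ≤ ε / 2 * (k : ℝ) ^ 2 := by positivity
      linarith
    · have hk0 : (0 : ℝ) < k ^ 2 := by
        have : (0 : ℝ) < k := by exact_mod_cast (by omega : 0 < k)
        positivity
      have := hn k (by omega)
      rw [Real.dist_eq, sub_zero, abs_div, abs_of_pos hk0, div_lt_iff₀ hk0] at this
      linarith
  obtain ⟨K, hK⟩ := hsq'
  refine ⟨K + 2 / ε, fun n => ?_⟩
  set k := n.sqrt with hk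
  have h1 : k ^ 2 ≤ n := Nat.sqrt_le' n
  have h2 : n ≤ k ^ 2 + 2 * k := by
    have := Nat.sqrt_le_add n
    rw [← hk] at this
    nlinarith
  obtain ⟨l, hl⟩ := Nat.exists_eq_add_of_le h1
  have hl2 : (l : ℝ) ≤ 2 * k := by exact_mod_cast (by omega : l ≤ 2 * k)
  have h3 := abs_le_of_abs_sub_le h (k ^ 2) l
  rw [← hl] at h3
  have h4 := hK k
  -- The gap `2 k` is split by the arithmetic-geometric mean inequality; the first term uses up the
  -- other half of `ε`.
  have h5 : (2 : ℝ) * k ≤ ε / 2 * (k : ℝ) ^ 2 + 2 / ε := by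
    have : ε / 2 * (k : ℝ) ^ 2 + 2 / ε - 2 * k = (ε * k - 2) ^ 2 / (2 * ε) := by
      field_simp; ring
    have : 0 ≤ (ε * k - 2) ^ 2 / (2 * ε) := by positivity
    linarith
  have h6 : (k : ℝ) ^ 2 ≤ n := by exact_mod_cast h1
  nlinarith

namespace Inputs

variable {Ω : Type*} {D : Inputs Ω M}

/-- The number of successful green transmissions of station `j` before slot `t` in the network
with saturated green queues. -/
noncomputable def service (D : Inputs Ω M) (x : State M) (j : Fin M) (t : ℕ) (ω : Ω) : ℝ :=
  ∑ s ∈ Finset.range t, saturated (D.chain x s ω) (D.slot s ω).coin j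

/-- The difference between the service and the sum of its conditional means. -/
noncomputable def noise (D : Inputs Ω M) (p : ℝ) (x : State M) (j : Fin M) (t : ℕ) (ω : Ω) : ℝ :=
  ∑ s ∈ Finset.range t,
    (saturated (D.chain x s ω) (D.slot s ω).coin j - rate p (D.chain x s ω) j)

/-- Since `rate` is affine in the red indicators, its sum over time involves only the total number
of red transmissions per station, which the balance `sum_sendsRed` expresses by arrivals and queue
lengths. -/
lemma service_eq (p : ℝ) (x : State M) (j : Fin M) (t : ℕ) (ω : Ω) :
    D.service x j t ω = D.noise p x j t ω + p * (1 - p) ^ (M - 1) * t +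
      (p * (1 - p) ^ (M - 2) - p * (1 - p) ^ (M - 1)) * (∑ i ∈ Finset.univ.erase j,
        (x.red i + D.redArrivals i t ω - D.redQueue x i t ω)) -
      p * (1 - p) ^ (M - 1) * (x.red j + D.redArrivals j t ω - D.redQueue x j t ω) := by
  simp only [← sum_sendsRed]
  rw [Finset.sum_comm, Finset.mul_sum, Finset.mul_sum, service, noise, Finset.sum_sub_distrib]
  simp only [rate, Finset.sum_sub_distrib, Finset.sum_add_distrib, Finset.sum_const,
    Finset.card_range, nsmul_eq_mul]
  ring

variable [MeasurableSpace Ω] {P : Measure Ω} {p : ℝ}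

namespace IsAdmissible

variable (hD : D.IsAdmissible P p) [IsProbabilityMeasure P]

include hD

lemma measure_coin (hp0 : 0 ≤ p) (hp1 : p ≤ 1) (j : Fin M) (S : Finset (Fin M)) (hj : j ∉ S) :
    P.real {ω | D.coin 0 j ω = true ∧ ∀ i ∈ S, D.coin 0 i ω = false} =
      p * (1 - p) ^ S.card := by
  have hind : iIndepFun (fun i => D.value (Label.coin 0 i)) P :=
    hD.indep.precomp (g := fun i => Label.coin 0 i) fun a b h => by simpa using h
  have h := hind.meas_biInter (S := insert j S)
    (s := fun i => D.value (Label.coin 0 i) ⁻¹' {if i = j then 1 else 0})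
    fun i _ => ⟨_, measurableSet_singleton _, rfl⟩
  have hfalse : ∀ i, P {ω | D.coin 0 i ω = false} = ENNReal.ofReal (1 - p) := fun i => by
    have hc : {ω | D.coin 0 i ω = false} = {ω | D.coin 0 i ω = true}ᶜ := by ext; simp
    have hm : MeasurableSet {ω | D.coin 0 i ω = true} :=
      hD.measurable_coin 0 i (measurableSet_singleton true)
    rw [hc, prob_compl_eq_one_sub hm, hD.coin_bernoulli, ENNReal.ofReal_sub _ hp0,
      ENNReal.ofReal_one]
  have hset : {ω | D.coin 0 j ω = true ∧ ∀ i ∈ S, D.coin 0 i ω = false} =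
      ⋂ i ∈ insert j S, D.value (Label.coin 0 i) ⁻¹' {if i = j then 1 else 0} := by
    ext ω
    simp only [Set.mem_ofPred_eq, Set.mem_iInter, Set.mem_preimage, Set.mem_singleton_iff,
      Finset.forall_mem_insert, value, if_true, Bool.toNat_eq_one]
    refine and_congr_right fun _ => forall₂_congr fun i hi => ?_
    rw [if_neg (ne_of_mem_of_not_mem hi hj), Bool.toNat_eq_zero]
  have hj1 : D.value (Label.coin 0 j) ⁻¹' {if j = j then 1 else 0} =
      {ω | D.coin 0 j ω = true} := by
    ext ω; simp [value]
  rw [measureReal_def, hset, h, Finset.prod_insert hj, hj1, hD.coin_bernoulli,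
    Finset.prod_congr rfl (g := fun _ => ENNReal.ofReal (1 - p)) fun i hi => ?_,
    Finset.prod_const, ENNReal.toReal_mul, ENNReal.toReal_pow, ENNReal.toReal_ofReal hp0,
    ENNReal.toReal_ofReal (by linarith)]
  rw [← hfalse i, if_neg (ne_of_mem_of_not_mem hi hj)]
  congr 1
  ext ω; simp [value]

/-- At most one station sends red. If it is `j`, success is impossible; if it is another one, `M -
2` competitors must be silent; if there is none, `M - 1` must be. -/
lemma integral_saturated (hp0 : 0 ≤ p) (hp1 : p ≤ 1) (x : State M) (j : Fin M) :
    ∫ ω, saturated x (D.slot 0 ω).coin j ∂P = rate p x j := by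
  classical
  have hred : ∀ i i', SendsRed x i → SendsRed x i' → i = i' := fun i i' h h' =>
    h.1.trans h'.1.symm
  have hM : 1 ≤ M := j.pos
  by_cases hj : SendsRed x j
  · have h1 : ∑ i ∈ Finset.univ.erase j, (if SendsRed x i then (1 : ℝ) else 0) = 0 :=
      Finset.sum_eq_zero fun i hi =>
        if_neg fun h => (Finset.ne_of_mem_erase hi) (hred i j h hj)
    have h2 : ∀ c, saturated x c j = 0 := fun c => if_neg fun h => h.1 hj
    rw [rate, h1, if_pos hj]
    simp [h2]
  · set S : Finset (Fin M) := (Finset.univ.erase j).filter fun i => ¬ SendsRed x i with hS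
    have hset : MeasurableSet {ω | D.coin 0 j ω = true ∧ ∀ i ∈ S, D.coin 0 i ω = false} := by
      refine (hD.measurable_coin 0 j (measurableSet_singleton true)).inter ?_
      have : {ω | ∀ i ∈ S, D.coin 0 i ω = false} = ⋂ i ∈ S, D.coin 0 i ⁻¹' {false} := by
        ext; simp
      change MeasurableSet {ω | ∀ i ∈ S, D.coin 0 i ω = false}
      rw [this]
      exact Finset.measurableSet_biInter _ fun i _ =>
        hD.measurable_coin 0 i (measurableSet_singleton false)
    have h1 : ∀ ω, saturated x (D.slot 0 ω).coin j =
        {ω | D.coin 0 j ω = true ∧ ∀ i ∈ S, D.coin 0 i ω = false}.indicator 1 ω := by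
      intro ω
      simp [saturated, hj, Set.indicator_apply, S, slot]
    simp_rw [h1]
    rw [integral_indicator_one hset, hD.measure_coin hp0 hp1 j S (by simp [S]), rate, if_neg hj]
    by_cases hex : ∃ i, SendsRed x i
    · obtain ⟨i, hi⟩ := hex
      have hij : i ≠ j := fun h => hj (h ▸ hi)
      have hSe : S = (Finset.univ.erase j).erase i := by
        ext i'
        simp only [S, Finset.mem_filter, Finset.mem_erase, Finset.mem_univ, and_true]
        exact ⟨fun h => ⟨fun h' => h.2 (h' ▸ hi), h.1⟩, fun h => ⟨h.2, fun h' => h.1 (hred _ _ h' hi)⟩⟩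
      have hsum : ∑ i ∈ Finset.univ.erase j, (if SendsRed x i then (1 : ℝ) else 0) = 1 := by
        rw [Finset.sum_eq_single_of_mem i (by simp [hij])]
        · rw [if_pos hi]
        · exact fun i' _ h => if_neg fun h' => h (hred _ _ h' hi)
      have hcard : S.card = M - 2 := by
        rw [hSe, Finset.card_erase_of_mem (by simp [hij]), Finset.card_erase_of_mem (by simp)]
        simp
        omega
      rw [hsum, hcard]
      ring
    · rw [not_exists] at hex
      have hSe : S = Finset.univ.erase j := by
        ext i'
        simp only [S, Finset.mem_filter]
        exact ⟨fun h => h.1, fun h => ⟨h, hex i'⟩⟩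
      have hsum : ∑ i ∈ Finset.univ.erase j, (if SendsRed x i then (1 : ℝ) else 0) = 0 :=
        Finset.sum_eq_zero fun i _ => if_neg (hex i)
      have hcard : S.card = M - 1 := by
        rw [hSe, Finset.card_erase_of_mem (by simp)]
        simp
      rw [hsum, hcard]
      ring

omit [IsProbabilityMeasure P] in
lemma integrable_saturated [IsFiniteMeasure P] (x : State M) (j : Fin M) :
    Integrable (fun ω => saturated x (D.slot 0 ω).coin j) P := by
  refine Integrable.of_bound (C := 1) ((measurable_of_countable fun u : SlotInput M =>
    saturated x u.coin j).comp (hD.measurable_slot 0)).aestronglyMeasurable (.of_forall fun ω => ?_)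
  rw [Real.norm_eq_abs, abs_of_nonneg (saturated_nonneg _ _ _)]
  exact saturated_le_one _ _ _

lemma abs_saturated_sub_rate_le (hp0 : 0 ≤ p) (hp1 : p ≤ 1) (x : State M) (c : Fin M → Bool)
    (j : Fin M) : |saturated x c j - rate p x j| ≤ 1 := by
  have h1 := saturated_nonneg x c j
  have h2 := saturated_le_one x c j
  have h3 : 0 ≤ rate p x j := by
    rw [← hD.integral_saturated hp0 hp1]
    exact integral_nonneg fun ω => saturated_nonneg _ _ _
  have h4 : rate p x j ≤ 1 := by
    rw [← hD.integral_saturated hp0 hp1]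
    calc _ ≤ ∫ _, (1 : ℝ) ∂P := integral_mono (hD.integrable_saturated x j) (integrable_const _)
          fun ω => saturated_le_one _ _ _
      _ = 1 := by simp
  exact abs_le.2 ⟨by linarith, by linarith⟩

/-- A function of the past and of the present slot has mean zero if it is centered in the latter. -/
lemma integral_slot_eq_zero {α : Type*} [MeasurableSpace α] {t : ℕ} {Z : Ω → α}
    (hZ : Measurable[D.info {s | s < t}] Z) {f : α × SlotInput M → ℝ} (hf : Measurable f)
    (hint : Integrable (fun ω => f (Z ω, D.slot t ω)) P)
    (h0 : ∀ a, ∫ ω, f (a, D.slot 0 ω) ∂P = 0) :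
    ∫ ω, f (Z ω, D.slot t ω) ∂P = 0 := by
  have hZ' : Measurable Z := hZ.mono (hD.info_le _) le_rfl
  have hind : IndepFun Z (D.slot t) P :=
    hD.indepFun_of_info (S := {s | s < t}) (T := {t}) (by simp) hZ
      (D.measurable_slot_info (Set.mem_singleton t))
  have hmap := (indepFun_iff_map_prod_eq_prod_map_map hZ'.aemeasurable
    (hD.measurable_slot t).aemeasurable).1 hind
  have hprod := hZ'.prodMk (hD.measurable_slot t)
  have := Measure.isProbabilityMeasure_map (μ := P) (hD.measurable_slot 0).aemeasurable
  have := Measure.isProbabilityMeasure_map (μ := P) hZ'.aemeasurable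
  have hint' : Integrable f ((P.map Z).prod (P.map (D.slot 0))) := by
    rw [← (hD.identDistrib_slot t).map_eq, ← hmap]
    exact (integrable_map_measure hf.aestronglyMeasurable hprod.aemeasurable).2 hint
  calc ∫ ω, f (Z ω, D.slot t ω) ∂P
      = ∫ q, f q ∂(P.map fun ω => (Z ω, D.slot t ω)) :=
        (integral_map hprod.aemeasurable hf.aestronglyMeasurable).symm
    _ = ∫ q, f q ∂((P.map Z).prod (P.map (D.slot 0))) := by
        rw [hmap, (hD.identDistrib_slot t).map_eq]
    _ = ∫ z, ∫ u, f (z, u) ∂(P.map (D.slot 0)) ∂(P.map Z) := integral_prod _ hint'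
    _ = ∫ _, (0 : ℝ) ∂(P.map Z) := by
        congr 1 with z
        exact (integral_map (hD.measurable_slot 0).aemeasurable
          (hf.comp measurable_prodMk_left).aestronglyMeasurable).trans (h0 z)
    _ = 0 := integral_zero _ _

omit hD [IsProbabilityMeasure P] [MeasurableSpace Ω] in
lemma measurable_noise_info (x : State M) (j : Fin M) (t : ℕ) :
    Measurable[D.info {s | s < t}] (D.noise p x j t) := by
  refine Finset.measurable_sum _ fun s hs => ?_
  rw [Finset.mem_range] at hs
  have h1 : Measurable[D.info {s | s < t}] (D.chain x s) :=
    D.measurable_chain_info x fun r hr => hr.trans hs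
  have h2 : Measurable[D.info {s | s < t}] (D.slot s) := D.measurable_slot_info hs
  exact (measurable_of_countable fun q : State M × SlotInput M =>
    saturated q.1 q.2.coin j - rate p q.1 j).comp (h1.prodMk h2)

omit [IsProbabilityMeasure P] in
lemma measurable_noise (x : State M) (j : Fin M) (t : ℕ) : Measurable (D.noise p x j t) :=
  (measurable_noise_info x j t).mono (hD.info_le _) le_rfl

lemma abs_noise_le (hp0 : 0 ≤ p) (hp1 : p ≤ 1) (x : State M) (j : Fin M) (t : ℕ) (ω : Ω) :
    |D.noise p x j t ω| ≤ t := by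
  calc |D.noise p x j t ω| ≤ ∑ s ∈ Finset.range t, (1 : ℝ) :=
        (Finset.abs_sum_le_sum_abs _ _).trans <| Finset.sum_le_sum fun s _ =>
          hD.abs_saturated_sub_rate_le hp0 hp1 _ _ _
    _ = t := by simp

/-- Martingale increments are orthogonal to the past, and here each is at most one in absolute
value. The bound does not depend on `x`. -/
lemma integral_noise_sq_le (hp0 : 0 ≤ p) (hp1 : p ≤ 1) (x : State M) (j : Fin M) (t : ℕ) :
    ∫ ω, D.noise p x j t ω ^ 2 ∂P ≤ t := by
  induction t with
  | zero => simp [noise]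
  | succ t ih =>
    set Y : Ω → ℝ := fun ω =>
      saturated (D.chain x t ω) (D.slot t ω).coin j - rate p (D.chain x t ω) j with hY
    have hYm : Measurable Y := (measurable_of_countable fun q : State M × SlotInput M =>
      saturated q.1 q.2.coin j - rate p q.1 j).comp
        ((hD.measurable_chain x t).prodMk (hD.measurable_slot t))
    have hYb : ∀ ω, |Y ω| ≤ 1 := fun ω => hD.abs_saturated_sub_rate_le hp0 hp1 _ _ _
    have hN := hD.measurable_noise x j t
    have hNb := hD.abs_noise_le hp0 hp1 x j t
    have i1 : Integrable (fun ω => D.noise p x j t ω ^ 2) P := by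
      refine Integrable.of_bound (C := (t : ℝ) ^ 2) (hN.pow_const 2).aestronglyMeasurable
        (.of_forall fun ω => ?_)
      rw [norm_pow, Real.norm_eq_abs]
      exact pow_le_pow_left₀ (abs_nonneg _) (hNb ω) 2
    have i2 : Integrable (fun ω => D.noise p x j t ω * Y ω) P := by
      refine Integrable.of_bound (C := (t : ℝ) * 1) (hN.mul hYm).aestronglyMeasurable
        (.of_forall fun ω => ?_)
      rw [norm_mul, Real.norm_eq_abs, Real.norm_eq_abs]
      exact mul_le_mul (hNb ω) (hYb ω) (abs_nonneg _) (Nat.cast_nonneg _)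
    have i3 : Integrable (fun ω => Y ω ^ 2) P := by
      refine Integrable.of_bound (C := (1 : ℝ) ^ 2) (hYm.pow_const 2).aestronglyMeasurable
        (.of_forall fun ω => ?_)
      rw [norm_pow, Real.norm_eq_abs]
      exact pow_le_pow_left₀ (abs_nonneg _) (hYb ω) 2
    have hzero : ∫ ω, D.noise p x j t ω * Y ω ∂P = 0 := by
      have hZ : Measurable[D.info {s | s < t}] fun ω => (D.noise p x j t ω, D.chain x t ω) :=
        (measurable_noise_info x j t).prodMk (D.measurable_chain_info x fun s hs => hs)
      refine hD.integral_slot_eq_zero hZ (f := fun q : (ℝ × State M) × SlotInput M =>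
        q.1.1 * (saturated q.1.2 q.2.coin j - rate p q.1.2 j)) ?_ i2 fun a => ?_
      · refine (measurable_fst.comp measurable_fst).mul ?_
        exact (measurable_of_countable fun q : State M × SlotInput M =>
          saturated q.1 q.2.coin j - rate p q.1 j).comp
            ((measurable_snd.comp measurable_fst).prodMk measurable_snd)
      · simp only
        rw [integral_const_mul, integral_sub (hD.integrable_saturated _ j) (integrable_const _),
          hD.integral_saturated hp0 hp1]
        simp
    have hsucc : ∀ ω, D.noise p x j (t + 1) ω ^ 2 =
        D.noise p x j t ω ^ 2 + 2 * (D.noise p x j t ω * Y ω) + Y ω ^ 2 := fun ω => by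
      rw [noise, Finset.sum_range_succ, ← noise]
      ring
    have hY2 : ∫ ω, Y ω ^ 2 ∂P ≤ 1 := by
      calc ∫ ω, Y ω ^ 2 ∂P ≤ ∫ _, (1 : ℝ) ∂P := integral_mono i3 (integrable_const _) fun ω => by
            have := hYb ω
            exact (sq_le_one_iff_abs_le_one _).2 this
        _ = 1 := by simp
    have i12 : Integrable (fun ω => D.noise p x j t ω ^ 2 + 2 * (D.noise p x j t ω * Y ω)) P :=
      i1.add (i2.const_mul 2)
    simp_rw [hsucc]
    rw [integral_add i12 i3, integral_add i1 (i2.const_mul 2), integral_const_mul, hzero]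
    push_cast
    linarith

lemma integrable_noise (hp0 : 0 ≤ p) (hp1 : p ≤ 1) (x : State M) (j : Fin M) (t : ℕ) :
    Integrable (D.noise p x j t) P :=
  Integrable.of_bound (C := t) (hD.measurable_noise x j t).aestronglyMeasurable
    (.of_forall fun ω => hD.abs_noise_le hp0 hp1 x j t ω)

lemma integral_abs_noise_le (hp0 : 0 ≤ p) (hp1 : p ≤ 1) (x : State M) (j : Fin M) (t : ℕ) :
    ∫ ω, |D.noise p x j t ω| ∂P ≤ √t := by
  rcases Nat.eq_zero_or_pos t with rfl | ht
  · simp [noise]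
  have hs : 0 < √(t : ℝ) := Real.sqrt_pos.2 (by exact_mod_cast ht)
  have hss : √(t : ℝ) * √t = t := Real.mul_self_sqrt (Nat.cast_nonneg _)
  have i1 : Integrable (fun ω => D.noise p x j t ω ^ 2) P := by
    refine Integrable.of_bound (C := (t : ℝ) ^ 2)
      ((hD.measurable_noise x j t).pow_const 2).aestronglyMeasurable (.of_forall fun ω => ?_)
    rw [norm_pow, Real.norm_eq_abs]
    exact pow_le_pow_left₀ (abs_nonneg _) (hD.abs_noise_le hp0 hp1 x j t ω) 2
  calc ∫ ω, |D.noise p x j t ω| ∂P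
      -- The pointwise inequality `2 |N| √t ≤ N² + t` takes the place of Cauchy–Schwarz.
      ≤ ∫ ω, (D.noise p x j t ω ^ 2 * (1 / (2 * √t)) + √t / 2) ∂P := by
        refine integral_mono (hD.integrable_noise hp0 hp1 x j t).abs
          ((i1.mul_const _).add (integrable_const _)) fun ω => ?_
        have h : D.noise p x j t ω ^ 2 * (1 / (2 * √t)) + √t / 2 - |D.noise p x j t ω| =
            (|D.noise p x j t ω| - √t) ^ 2 / (2 * √t) := by
          rw [← sq_abs (D.noise p x j t ω)]
          field_simp
          ring
        have : 0 ≤ (|D.noise p x j t ω| - √t) ^ 2 / (2 * √(t : ℝ)) := by positivity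
        simp only
        linarith
    _ = (∫ ω, D.noise p x j t ω ^ 2 ∂P) * (1 / (2 * √t)) + √t / 2 := by
        rw [integral_add (i1.mul_const _) (integrable_const _), integral_mul_const]
        simp
    _ ≤ t * (1 / (2 * √t)) + √t / 2 := by
        gcongr
        exact hD.integral_noise_sq_le hp0 hp1 x j t
    _ = √t := by
        have : (t : ℝ) * (1 / (2 * √t)) = √t / 2 := by
          rw [← hss]
          field_simp
          rw [Real.sqrt_sq hs.le]
        linarith

/-- Along the squares the normalized second moments are at most `1 / k ^ 2`, hence summable. Bounded
increments fill the gaps. -/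
lemma ae_tendsto_noise (hp0 : 0 ≤ p) (hp1 : p ≤ 1) (x : State M) (j : Fin M) :
    ∀ᵐ ω ∂P, Tendsto (fun t : ℕ => D.noise p x j t ω / t) atTop (𝓝 0) := by
  set g : ℕ → Ω → ℝ := fun k ω => (D.noise p x j (k ^ 2) ω / (k : ℝ) ^ 2) ^ 2 with hg
  have hgm : ∀ k, Measurable (g k) := fun k =>
    ((hD.measurable_noise x j _).div_const _).pow_const 2
  have hgi : ∀ k, ∫⁻ ω, ENNReal.ofReal (g k ω) ∂P ≤ ENNReal.ofReal (1 / (k : ℝ) ^ 2) := by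
    intro k
    have i1 : Integrable (g k) P := by
      refine Integrable.of_bound (C := 1) (hgm k).aestronglyMeasurable (.of_forall fun ω => ?_)
      rw [hg, Real.norm_eq_abs, abs_of_nonneg (sq_nonneg _), sq_le_one_iff_abs_le_one, abs_div,
        abs_of_nonneg (by positivity : (0 : ℝ) ≤ (k : ℝ) ^ 2)]
      refine div_le_one_of_le₀ ?_ (by positivity)
      exact_mod_cast hD.abs_noise_le hp0 hp1 x j (k ^ 2) ω
    rw [← ofReal_integral_eq_lintegral_ofReal i1 (.of_forall fun ω => sq_nonneg _)]
    refine ENNReal.ofReal_le_ofReal ?_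
    have h := hD.integral_noise_sq_le hp0 hp1 x j (k ^ 2)
    simp only [hg, div_pow]
    rw [integral_div]
    rcases Nat.eq_zero_or_pos k with rfl | hk
    · simp
    · have hk0 : (0 : ℝ) < k := by exact_mod_cast hk
      rw [div_le_div_iff₀ (by positivity) (by positivity)]
      push_cast at h
      nlinarith [sq_nonneg ((k : ℝ))]
  have hsum : ∫⁻ ω, ∑' k, ENNReal.ofReal (g k ω) ∂P ≠ ∞ := by
    rw [lintegral_tsum fun k => (hgm k).ennreal_ofReal.aemeasurable]
    refine ne_top_of_le_ne_top ?_ (ENNReal.tsum_le_tsum hgi)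
    have hs : Summable fun k : ℕ => 1 / (k : ℝ) ^ 2 := Real.summable_one_div_nat_pow.2 (by norm_num)
    rw [← ENNReal.ofReal_tsum_of_nonneg (fun k => by positivity) hs]
    exact ENNReal.ofReal_ne_top
  have hae := ae_lt_top' (AEMeasurable.tsum fun k =>
    (hgm k).ennreal_ofReal.aemeasurable) hsum
  filter_upwards [hae] with ω hω
  have h1 := ENNReal.tendsto_atTop_zero_of_tsum_ne_top hω.ne
  have h2 : Tendsto (fun k => g k ω) atTop (𝓝 0) := by
    have := (ENNReal.tendsto_toReal ENNReal.zero_ne_top).comp h1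
    simpa [Function.comp_def, ENNReal.toReal_ofReal (sq_nonneg _), hg] using this
  have h3 : Tendsto (fun k : ℕ => D.noise p x j (k ^ 2) ω / (k : ℝ) ^ 2) atTop (𝓝 0) := by
    rw [tendsto_zero_iff_abs_tendsto_zero]
    have := (Real.continuous_sqrt.tendsto 0).comp h2
    simpa [Function.comp_def, Real.sqrt_sq_eq_abs, hg] using this
  refine tendsto_div_of_tendsto_div_sq (fun n => ?_) h3
  rw [noise, Finset.sum_range_succ, ← noise, add_sub_cancel_left]
  exact hD.abs_saturated_sub_rate_le hp0 hp1 _ _ _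

end IsAdmissible

end Inputs

/-! ### Comparison with the saturated network and instability -/

lemma saturated_congr {x y : State M} (ht : x.turn = y.turn) (hr : x.red = y.red)
    (c : Fin M → Bool) (j : Fin M) : saturated x c j = saturated y c j := by
  simp only [saturated, SendsRed, ht, hr]

lemma green_next_eq {x : State M} (hx : ∀ i, 0 < x.green i) (u : SlotInput M) (j : Fin M) :
    ((next x u).green j : ℝ) = x.green j + u.greenIn j - saturated x u.coin j := by
  have h : SendsGreen x u j ↔
      ¬ SendsRed x j ∧ u.coin j = true ∧ ∀ i, i ≠ j → ¬ SendsRed x i → u.coin i = false := by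
    simp only [SendsGreen, TriesGreen, hx, true_and, not_and, Bool.not_eq_true, and_assoc]
  have hj : 1 ≤ x.green j := hx j
  simp only [next, saturated, ← h]
  split_ifs
  · push_cast [Nat.cast_sub hj]; ring
  · push_cast; ring

/-- Only the queue of `j` has to be non-empty: empty green queues at other stations remove
competitors, so a success in the saturated network is also one here. -/
lemma green_next_le_saturated {x : State M} (u : SlotInput M) {j : Fin M} (hx : 0 < x.green j) :
    ((next x u).green j : ℝ) ≤ x.green j + u.greenIn j - saturated x u.coin j := by
  have hj : 1 ≤ x.green j := hx
  by_cases h : ¬ SendsRed x j ∧ u.coin j = true ∧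
      ∀ i, i ≠ j → ¬ SendsRed x i → u.coin i = false
  · have hs : SendsGreen x u j := by
      refine ⟨⟨hx, h.1, h.2.1⟩, fun i hi hi' => ?_⟩
      have := h.2.2 i hi hi'.2.1
      rw [hi'.2.2] at this
      exact absurd this (by simp)
    simp only [next, saturated, if_pos hs, if_pos h]
    push_cast [Nat.cast_sub hj]
    linarith
  · simp only [next, saturated, if_neg h]
    have : (if SendsGreen x u j then x.green j - 1 else x.green j) ≤ x.green j := by
      split_ifs <;> omega
    have : ((if SendsGreen x u j then x.green j - 1 else x.green j : ℕ) : ℝ) ≤ x.green j := by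
      exact_mod_cast this
    push_cast at this ⊢
    linarith

/-- The mean number of successful green transmissions per slot of one station in the saturated
network, if the mean number of red messages per slot is `r`. -/
noncomputable def serviceRate (M : ℕ) (p r : ℝ) : ℝ :=
  p * (1 - p) ^ (M - 1) +
    (p * (1 - p) ^ (M - 2) - p * (1 - p) ^ (M - 1)) * (((M : ℝ) - 1) * (r / M)) -
    p * (1 - p) ^ (M - 1) * (r / M)

lemma exists_forall_neg_le_of_tendsto {f : ℕ → ℝ} {c : ℝ} (hc : 0 < c)
    (h : Tendsto (fun t : ℕ => f t / t) atTop (𝓝 c)) : ∃ K : ℕ, ∀ t, -(K : ℝ) ≤ f t := by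
  have h0 : Tendsto (fun t : ℕ => (f t - c * t) / t) atTop (𝓝 0) := by
    have := h.sub_const c
    rw [sub_self] at this
    refine this.congr' ?_
    filter_upwards [eventually_gt_atTop 0] with t ht
    have : (0 : ℝ) < t := by exact_mod_cast ht
    field_simp
  -- With tolerance equal to the drift `c` itself, the linear terms cancel and only the constant
  -- remains.
  obtain ⟨K, hK⟩ := (tendsto_div_natCast_zero_iff _).1 h0 c hc
  obtain ⟨k, hk⟩ := exists_nat_ge K
  refine ⟨k, fun t => ?_⟩
  have := (abs_le.1 (hK t)).1
  linarith

namespace Inputs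

variable {Ω : Type*} {D : Inputs Ω M}

lemma service_congr {x y : State M} (ht : x.turn = y.turn) (hr : x.red = y.red) (j : Fin M)
    (t : ℕ) (ω : Ω) : D.service x j t ω = D.service y j t ω :=
  Finset.sum_congr rfl fun s _ =>
    saturated_congr (D.chain_congr_red ht hr s ω).1 (D.chain_congr_red ht hr s ω).2 _ _

lemma greenArrivals_succ (i : Fin M) (t : ℕ) (ω : Ω) :
    D.greenArrivals i (t + 1) ω = D.greenArrivals i t ω + (D.slot t ω).greenIn i :=
  Finset.sum_range_succ _ _

lemma service_succ (x : State M) (j : Fin M) (t : ℕ) (ω : Ω) :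
    D.service x j (t + 1) ω =
      D.service x j t ω + saturated (D.chain x t ω) (D.slot t ω).coin j :=
  Finset.sum_range_succ _ _

/-- As long as no green queue is empty, the network behaves like the saturated one. -/
lemma green_chain_eq {x : State M} {ω : Ω}
    (h : ∀ j t, 0 < x.green j + D.greenArrivals j t ω - D.service x j t ω) (t : ℕ) (j : Fin M) :
    ((D.chain x t ω).green j : ℝ) = x.green j + D.greenArrivals j t ω - D.service x j t ω := by
  induction t generalizing j with
  | zero => simp [chain, greenArrivals, service]
  | succ t ih =>
    have hpos : ∀ i, 0 < (D.chain x t ω).green i := fun i => by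
      have := h i t
      rw [← ih i] at this
      exact_mod_cast this
    rw [chain, green_next_eq hpos, ih, greenArrivals_succ, service_succ]
    ring

variable [MeasurableSpace Ω] {P : Measure Ω} {p : ℝ}

namespace IsAdmissible

variable (hD : D.IsAdmissible P p) [IsProbabilityMeasure P]

include hD

/-- Divide `service_eq` by `t`: the noise and the red queues disappear, and the red arrivals at each
station contribute `r / M`. -/
lemma ae_tendsto_service (hM : 1 ≤ M) (hp0 : 0 ≤ p) (hp1 : p ≤ 1)
    (hR : ∫ ω, (D.redCount 0 ω : ℝ) ∂P < 1) (c j : Fin M) :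
    ∀ᵐ ω ∂P, Tendsto (fun t : ℕ => D.service (emptyState c) j t ω / t) atTop
      (𝓝 (serviceRate M p (∫ ω, (D.redCount 0 ω : ℝ) ∂P))) := by
  filter_upwards [hD.ae_tendsto_noise hp0 hp1 (emptyState c) j,
    ae_all_iff.2 fun i => hD.ae_tendsto_redArrivals hM i,
    ae_all_iff.2 fun i => hD.ae_tendsto_redQueue_empty hM hR c i] with ω h1 h2 h3
  set r := ∫ ω, (D.redCount 0 ω : ℝ) ∂P
  have h4 : ∀ i, Tendsto (fun t : ℕ => (((emptyState c).red i : ℝ) + D.redArrivals i t ω -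
      D.redQueue (emptyState c) i t ω) / t) atTop (𝓝 (r / M)) := fun i => by
    have := (h2 i).sub (h3 i)
    rw [sub_zero] at this
    refine this.congr fun t => ?_
    simp only [emptyState, Pi.zero_apply, Nat.cast_zero, zero_add, sub_div]
  have h5 := (((h1.add_const (p * (1 - p) ^ (M - 1))).add
    ((tendsto_finsetSum (Finset.univ.erase j) fun i _ => h4 i).const_mul
      (p * (1 - p) ^ (M - 2) - p * (1 - p) ^ (M - 1)))).sub
    ((h4 j).const_mul (p * (1 - p) ^ (M - 1))))
  have h6 : (0 + p * (1 - p) ^ (M - 1)) + (p * (1 - p) ^ (M - 2) - p * (1 - p) ^ (M - 1)) *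
      (∑ i ∈ Finset.univ.erase j, r / M) - p * (1 - p) ^ (M - 1) * (r / M) =
      serviceRate M p r := by
    rw [Finset.sum_const, Finset.card_erase_of_mem (Finset.mem_univ j), Finset.card_univ,
      Fintype.card_fin, nsmul_eq_mul, Nat.cast_sub hM, serviceRate]
    push_cast
    ring
  rw [h6] at h5
  refine h5.congr' ?_
  filter_upwards [eventually_gt_atTop 0] with t ht
  have ht0 : (t : ℝ) ≠ 0 := by exact_mod_cast ht.ne'
  rw [D.service_eq p, ← Finset.sum_div]
  field_simp

theorem isUnstable_of_serviceRate_lt (hM : 1 ≤ M) (hp0 : 0 ≤ p) (hp1 : p ≤ 1)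
    (hR : ∫ ω, (D.redCount 0 ω : ℝ) ∂P < 1)
    (hG : serviceRate M p (∫ ω, (D.redCount 0 ω : ℝ) ∂P) <
      (∫ ω, (D.greenCount 0 ω : ℝ) ∂P) / M) : D.IsUnstable P := by
  rintro V hV ⟨hrec, -⟩
  let c : Fin M := ⟨0, hM⟩
  obtain ⟨b, hb⟩ : ∃ b, ∀ v ∈ V, v.green c ≤ b := by
    obtain ⟨b, hb⟩ := (hV.image fun v => v.green c).bddAbove
    exact ⟨b, fun v hv => hb (Set.mem_image_of_mem _ hv)⟩
  have hlow : ∀ᵐ ω ∂P, ∃ K : ℕ, ∀ j t,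
      -(K : ℝ) ≤ D.greenArrivals j t ω - D.service (emptyState c) j t ω := by
    filter_upwards [ae_all_iff.2 fun j => hD.ae_tendsto_service hM hp0 hp1 hR c j,
      ae_all_iff.2 fun j => hD.ae_tendsto_greenArrivals hM j] with ω h1 h2
    have : ∀ j, ∃ K : ℕ, ∀ t,
        -(K : ℝ) ≤ D.greenArrivals j t ω - D.service (emptyState c) j t ω := fun j => by
      refine exists_forall_neg_le_of_tendsto (sub_pos.2 hG) (((h2 j).sub (h1 j)).congr fun t => ?_)
      rw [sub_div]
    choose K hK using this
    refine ⟨Finset.univ.sup K, fun j t => le_trans ?_ (hK j t)⟩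
    have : (K j : ℝ) ≤ (Finset.univ.sup K : ℕ) := by
      exact_mod_cast Finset.le_sup (f := K) (Finset.mem_univ j)
    linarith
  -- For a fixed `K`, start with `K + b + 1` green messages everywhere. On the event in question all
  -- green queues then stay above `b`, so `V` is never hit, although recurrence makes this a null
  -- event. The start has the turn and red queues of `emptyState c`, hence the same saturated
  -- service.
  have hhit : ∀ᵐ ω ∂P, ∀ K : ℕ, ¬ ∀ j t,
      -(K : ℝ) ≤ D.greenArrivals j t ω - D.service (emptyState c) j t ω := by
    refine ae_all_iff.2 fun K => ?_
    let x : State M := ⟨c, 0, fun _ => K + b + 1⟩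
    filter_upwards [hrec x] with ω hω hK
    have hserv : ∀ j t, D.service x j t ω = D.service (emptyState c) j t ω := fun j t =>
      D.service_congr (x := x) (y := emptyState c) rfl rfl j t ω
    have hx : ∀ j, (x.green j : ℝ) = K + b + 1 := fun j => by simp [x]
    have hpos : ∀ j t, (b : ℝ) < x.green j + D.greenArrivals j t ω - D.service x j t ω :=
      fun j t => by
        rw [hserv, hx]
        linarith [hK j t]
    have hb0 : (0 : ℝ) ≤ b := Nat.cast_nonneg _
    have heq := D.green_chain_eq fun j t => hb0.trans_lt (hpos j t)
    have htop : D.returnTime V x ω = ⊤ := by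
      refine iInf₂_eq_top.2 fun t ht => absurd (hb _ ht.2) (not_le.2 ?_)
      have := hpos c t
      rw [← heq] at this
      exact_mod_cast this
    exact hω.ne htop
  have : ∀ᵐ ω ∂P, False := by
    filter_upwards [hlow, hhit] with ω ⟨K, hK⟩ h
    exact h K hK
  exact (NeZero.ne P) (by simpa using this)

end IsAdmissible

end Inputs

/-! ### Lyapunov drift and stability -/

/-- The length of the longest red queue. -/
def maxRed (x : State M) : ℕ := Finset.univ.sup x.red

/-- The length of the longest green queue. -/
def maxGreen (x : State M) : ℕ := Finset.univ.sup x.green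

lemma red_le_maxRed (x : State M) (i : Fin M) : x.red i ≤ maxRed x :=
  Finset.le_sup (Finset.mem_univ i)

lemma green_le_maxGreen (x : State M) (i : Fin M) : x.green i ≤ maxGreen x :=
  Finset.le_sup (Finset.mem_univ i)

lemma cast_sup_univ_le (hM : 1 ≤ M) {f : Fin M → ℕ} {b : ℝ} (h : ∀ i, (f i : ℝ) ≤ b) :
    ((Finset.univ.sup f : ℕ) : ℝ) ≤ b := by
  obtain ⟨i, -, hi⟩ := Finset.exists_mem_eq_sup Finset.univ ⟨⟨0, hM⟩, Finset.mem_univ _⟩ f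
  rw [hi]
  exact h i

lemma finite_setOf_max_le (a b : ℕ) : {x : State M | maxRed x ≤ a ∧ maxGreen x ≤ b}.Finite := by
  have hinj : Function.Injective fun x : State M => (x.turn, x.red, x.green) := fun x y h => by
    simp only [Prod.mk.injEq] at h
    exact State.ext h.1 h.2.1 h.2.2
  have hfin : ((Set.univ : Set (Fin M)) ×ˢ (Set.Iic (fun _ : Fin M => a) ×ˢ
      Set.Iic (fun _ : Fin M => b))).Finite :=
    Set.finite_univ.prod ((Set.finite_Iic _).prod (Set.finite_Iic _))
  refine (hfin.preimage hinj.injOn).subset fun x hx => ?_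
  exact ⟨Set.mem_univ _, fun i => (red_le_maxRed x i).trans hx.1,
    fun i => (green_le_maxGreen x i).trans hx.2⟩

namespace Inputs

variable {Ω : Type*} {D : Inputs Ω M}

lemma green_chain_le (x : State M) (j : Fin M) (t : ℕ) (ω : Ω) :
    ((D.chain x t ω).green j : ℝ) ≤ x.green j + D.greenArrivals j t ω := by
  induction t with
  | zero => simp [chain, greenArrivals]
  | succ t ih =>
    have : ((if SendsGreen (D.chain x t ω) (D.slot t ω) j then (D.chain x t ω).green j - 1
        else (D.chain x t ω).green j : ℕ) : ℝ) ≤ (D.chain x t ω).green j := by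
      exact_mod_cast (by split_ifs <;> omega)
    rw [greenArrivals_succ]
    simp only [chain, next]
    push_cast at this ⊢
    linarith

lemma green_chain_ge (x : State M) (j : Fin M) (t : ℕ) (ω : Ω) :
    x.green j ≤ (D.chain x t ω).green j + t := by
  induction t with
  | zero => simp [chain]
  | succ t ih =>
    have : (D.chain x t ω).green j ≤
        (if SendsGreen (D.chain x t ω) (D.slot t ω) j then (D.chain x t ω).green j - 1
        else (D.chain x t ω).green j) + 1 := by
      split_ifs <;> omega
    simp only [chain, next]
    omega

/-- A green queue that is long enough not to become empty is served at least as often as in the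
saturated network. -/
lemma green_chain_le_sub_service {x : State M} {j : Fin M} {m : ℕ} (hm : m ≤ x.green j) (ω : Ω) :
    ((D.chain x m ω).green j : ℝ) ≤
      x.green j + D.greenArrivals j m ω - D.service x j m ω := by
  have key : ∀ t ≤ m, ((D.chain x t ω).green j : ℝ) ≤
      x.green j + D.greenArrivals j t ω - D.service x j t ω := by
    intro t ht
    induction t with
    | zero => simp [chain, greenArrivals, service]
    | succ t ih =>
      have h1 := ih (by omega)
      have hpos : 0 < (D.chain x t ω).green j := by
        have := D.green_chain_ge x j t ω
        omega
      have h2 := green_next_le_saturated (D.slot t ω) hpos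
      rw [greenArrivals_succ, service_succ, chain]
      linarith
  exact key m le_rfl

/-- The total deviation of the processes that drive the network from their means `r` (red
arrivals), `g` (green arrivals) and of the saturated service. -/
noncomputable def deviation (D : Inputs Ω M) (p r g : ℝ) (x : State M) (m : ℕ) (ω : Ω) : ℝ :=
  ∑ i, (|D.redArrivals i m ω - m * (r / M)| + |D.greenArrivals i m ω - m * (g / M)| +
    |D.noise p x i m ω| + D.redQueue (emptyState x.turn) i m ω)

section Pathwise

variable {p r g : ℝ} {x : State M} {m : ℕ} {ω : Ω}

lemma le_deviation (i : Fin M) :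
    |D.redArrivals i m ω - m * (r / M)| + |D.greenArrivals i m ω - m * (g / M)| +
      |D.noise p x i m ω| + D.redQueue (emptyState x.turn) i m ω ≤ D.deviation p r g x m ω :=
  Finset.single_le_sum (f := fun i => |D.redArrivals i m ω - m * (r / M)| +
    |D.greenArrivals i m ω - m * (g / M)| + |D.noise p x i m ω| +
    D.redQueue (emptyState x.turn) i m ω)
    (fun i _ => by have := D.redQueue_nonneg (emptyState x.turn) i m ω; positivity)
    (Finset.mem_univ i)

lemma deviation_nonneg : 0 ≤ D.deviation p r g x m ω :=
  Finset.sum_nonneg fun i _ => by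
    have := D.redQueue_nonneg (emptyState x.turn) i m ω
    positivity

lemma maxRed_chain_le (hM : 1 ≤ M) :
    (maxRed (D.chain x m ω) : ℝ) ≤
      max (maxRed x - (1 - r) / M * m + D.deviation p r g x m ω + 1)
        (D.deviation p r g x m ω) := by
  refine cast_sup_univ_le hM fun i => ?_
  refine (D.redQueue_le_max hM x i m ω).trans (max_le_max ?_ ?_)
  · have h1 := D.le_deviation (p := p) (r := r) (g := g) (x := x) (m := m) (ω := ω) i
    have h2 := D.redQueue_nonneg (emptyState x.turn) i m ω
    have h3 := le_abs_self (D.redArrivals i m ω - m * (r / M))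
    have h4 := abs_nonneg (D.greenArrivals i m ω - m * (g / M))
    have h5 := abs_nonneg (D.noise p x i m ω)
    have h6 : (x.red i : ℝ) ≤ maxRed x := by exact_mod_cast red_le_maxRed x i
    have h7 : (1 - r) / M * m = m / M - m * (r / M) := by ring
    linarith
  · have h1 := D.le_deviation (p := p) (r := r) (g := g) (x := x) (m := m) (ω := ω) i
    have : 0 ≤ |D.redArrivals i m ω - m * (r / M)| + |D.greenArrivals i m ω - m * (g / M)| +
      |D.noise p x i m ω| := by positivity
    linarith

lemma maxGreen_chain_le (hM : 1 ≤ M) (hg : 0 ≤ g) :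
    (maxGreen (D.chain x m ω) : ℝ) ≤ maxGreen x + g * m + D.deviation p r g x m ω := by
  refine cast_sup_univ_le hM fun i => ?_
  have h0 := D.green_chain_le x i m ω
  have h1 := D.le_deviation (p := p) (r := r) (g := g) (x := x) (m := m) (ω := ω) i
  have h2 := D.redQueue_nonneg (emptyState x.turn) i m ω
  have h3 := abs_nonneg (D.redArrivals i m ω - m * (r / M))
  have h4 := le_abs_self (D.greenArrivals i m ω - m * (g / M))
  have h5 := abs_nonneg (D.noise p x i m ω)
  have h6 : (x.green i : ℝ) ≤ maxGreen x := by exact_mod_cast green_le_maxGreen x i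
  have h7 : g / M ≤ g := div_le_self hg (by exact_mod_cast hM)
  have h8 : m * (g / M) ≤ g * m := by
    rw [mul_comm g]
    exact mul_le_mul_of_nonneg_left h7 (Nat.cast_nonneg _)
  linarith

/-- If the red queues are short, then the saturated service is close to its long-run mean. -/
lemma service_ge (hp0 : 0 ≤ p) (hp1 : p ≤ 1) {δ : ℝ} (hδ : 0 ≤ δ)
    (hx : (maxRed x : ℝ) ≤ δ * m) (j : Fin M) :
    serviceRate M p r * m - δ * m - D.deviation p r g x m ω ≤
      D.service x j m ω - (D.greenArrivals j m ω - m * (g / M)) := by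
  have hM : 1 ≤ M := j.pos
  have hq0 : 0 ≤ 1 - p := by linarith
  have hq1 : 1 - p ≤ 1 := by linarith
  set α := p * (1 - p) ^ (M - 2) with hα
  set β := p * (1 - p) ^ (M - 1) with hβ
  -- As `0 ≤ β ≤ α`, red transmissions elsewhere help station `j` and its own hurt. So those of the
  -- others are bounded below and its own above; only the latter bound uses that red queues are
  -- short at the start.
  have hβ0 : 0 ≤ β := by positivity
  have hβα : β ≤ α := mul_le_mul_of_nonneg_left (pow_le_pow_of_le_one hq0 hq1 (by omega)) hp0
  have hα1 : α ≤ 1 := mul_le_one₀ hp1 (by positivity) (pow_le_one₀ hq0 hq1)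
  set a : Fin M → ℝ := fun i => |D.redArrivals i m ω - m * (r / M)| with ha
  set e : Fin M → ℝ := fun i => D.redQueue (emptyState x.turn) i m ω with he
  set d : Fin M → ℝ := fun i => |D.greenArrivals i m ω - m * (g / M)| + |D.noise p x i m ω| with hd
  have hd0 : ∀ i, 0 ≤ d i := fun i => by positivity
  have ha0 : ∀ i, 0 ≤ a i := fun i => abs_nonneg _
  have he0 : ∀ i, 0 ≤ e i := fun i => D.redQueue_nonneg _ i m ω
  have hlow : ∀ i, m * (r / M) - a i - e i ≤
      x.red i + D.redArrivals i m ω - D.redQueue x i m ω := fun i => by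
    have h1 := D.redQueue_le_add x i m ω
    have h2 := neg_abs_le (D.redArrivals i m ω - m * (r / M))
    simp only [ha, he]
    linarith
  have hup : x.red j + D.redArrivals j m ω - D.redQueue x j m ω ≤ δ * m + m * (r / M) + a j := by
    have h1 := D.redQueue_nonneg x j m ω
    have h2 := le_abs_self (D.redArrivals j m ω - m * (r / M))
    have h3 : (x.red j : ℝ) ≤ maxRed x := by exact_mod_cast red_le_maxRed x j
    simp only [ha]
    linarith
  have hsum : ∑ i ∈ Finset.univ.erase j, (m * (r / M) - a i - e i) ≤
      ∑ i ∈ Finset.univ.erase j, (x.red i + D.redArrivals i m ω - D.redQueue x i m ω) :=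
    Finset.sum_le_sum fun i _ => hlow i
  have hconst : ∑ i ∈ Finset.univ.erase j, (m * (r / M) - a i - e i) =
      ((M : ℝ) - 1) * (m * (r / M)) - ∑ i ∈ Finset.univ.erase j, (a i + e i) := by
    simp only [sub_sub, Finset.sum_sub_distrib, Finset.sum_const, nsmul_eq_mul]
    rw [Finset.card_erase_of_mem (Finset.mem_univ j), Finset.card_univ, Fintype.card_fin,
      Nat.cast_sub hM, Nat.cast_one]
  have hdev : ∑ i ∈ Finset.univ.erase j, (a i + e i) + (a j + d j) ≤ D.deviation p r g x m ω := by
    have : D.deviation p r g x m ω = ∑ i, (a i + e i + d i) :=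
      Finset.sum_congr rfl fun i _ => by simp only [ha, he, hd]; ring
    rw [this, ← Finset.sum_erase_add _ _ (Finset.mem_univ j)]
    have h1 : ∑ i ∈ Finset.univ.erase j, (a i + e i) ≤
        ∑ i ∈ Finset.univ.erase j, (a i + e i + d i) :=
      Finset.sum_le_sum fun i _ => le_add_of_nonneg_right (hd0 i)
    have h2 := he0 j
    linarith
  have hE0 : 0 ≤ ∑ i ∈ Finset.univ.erase j, (a i + e i) :=
    Finset.sum_nonneg fun i _ => add_nonneg (ha0 i) (he0 i)
  have h1 : (α - β) * (((M : ℝ) - 1) * (m * (r / M)) - ∑ i ∈ Finset.univ.erase j, (a i + e i)) ≤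
      (α - β) * ∑ i ∈ Finset.univ.erase j,
        (x.red i + D.redArrivals i m ω - D.redQueue x i m ω) :=
    mul_le_mul_of_nonneg_left (hconst ▸ hsum) (by linarith)
  have h2 : β * (x.red j + D.redArrivals j m ω - D.redQueue x j m ω) ≤
      β * (δ * m + m * (r / M) + a j) := mul_le_mul_of_nonneg_left hup hβ0
  have h3 : (α - β) * ∑ i ∈ Finset.univ.erase j, (a i + e i) ≤
      ∑ i ∈ Finset.univ.erase j, (a i + e i) := mul_le_of_le_one_left hE0 (by linarith)
  have h4 : β * a j ≤ a j := mul_le_of_le_one_left (ha0 j) (by linarith)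
  have h5 : β * (δ * m) ≤ δ * m := mul_le_of_le_one_left (by positivity) (by linarith)
  have h6 := neg_abs_le (D.noise p x j m ω)
  have h7 := le_abs_self (D.greenArrivals j m ω - m * (g / M))
  have h8 : d j = |D.greenArrivals j m ω - m * (g / M)| + |D.noise p x j m ω| := rfl
  have h9 : serviceRate M p r * m = β * m + (α - β) * (((M : ℝ) - 1) * (m * (r / M))) -
      β * (m * (r / M)) := by
    simp only [serviceRate, ← hα, ← hβ]; ring
  rw [D.service_eq p, h9, ← hα, ← hβ]
  rw [mul_sub] at h1
  rw [mul_add, mul_add] at h2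
  linarith

/-- A queue of length at least `m` receives at least the saturated service. A shorter one ends near
`m * (1 + g)` at most, which the lower bound on `maxGreen x` places below the target. -/
lemma maxGreen_chain_le_of_short_red (hM : 1 ≤ M) (hp0 : 0 ≤ p) (hp1 : p ≤ 1) (hg : 0 ≤ g)
    {δ : ℝ} (hδ : 0 ≤ δ) (hx : (maxRed x : ℝ) ≤ δ * m)
    (hxG : m * (1 + g + (serviceRate M p r - g / M)) ≤ maxGreen x) :
    (maxGreen (D.chain x m ω) : ℝ) ≤ maxGreen x - (serviceRate M p r - g / M) * m + δ * m +
      D.deviation p r g x m ω := by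
  refine cast_sup_univ_le hM fun j => ?_
  have h6 : (x.green j : ℝ) ≤ maxGreen x := by exact_mod_cast green_le_maxGreen x j
  rcases Nat.lt_or_ge (x.green j) m with hj | hj
  · have hj' : (x.green j : ℝ) ≤ m := by exact_mod_cast hj.le
    have h0 := D.green_chain_le x j m ω
    have h1 := D.le_deviation (p := p) (r := r) (g := g) (x := x) (m := m) (ω := ω) j
    have h2 := D.redQueue_nonneg (emptyState x.turn) j m ω
    have h3 := abs_nonneg (D.redArrivals j m ω - m * (r / M))
    have h4 := le_abs_self (D.greenArrivals j m ω - m * (g / M))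
    have h5 := abs_nonneg (D.noise p x j m ω)
    have h7 : g / M ≤ g := div_le_self hg (by exact_mod_cast hM)
    have h8 : m * (g / M) ≤ m * g := mul_le_mul_of_nonneg_left h7 (Nat.cast_nonneg _)
    have h9 : 0 ≤ δ * m := by positivity
    nlinarith
  · have h0 := D.green_chain_le_sub_service hj ω
    have h1 := D.service_ge (r := r) (g := g) (ω := ω) hp0 hp1 hδ hx j
    have h2 : (serviceRate M p r - g / M) * m = serviceRate M p r * m - m * (g / M) := by ring
    linarith

/-- The pathwise form of the drift inequality for the Lyapunov function
`maxGreen + C * maxRed`. -/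
lemma lyapunov_chain_le (hM : 1 ≤ M) (hp0 : 0 ≤ p) (hp1 : p ≤ 1) (hg : 0 ≤ g) {δ η : ℝ} {C : ℕ}
    (hδ : 0 ≤ δ) (hκ : serviceRate M p r - g / M = 4 * δ) (hη : η ≤ (1 - r) / M) (hη0 : 0 ≤ η)
    (hηδ : η ≤ δ) (hC : g + 3 * δ ≤ C * η)
    (hx : δ * m < maxRed x ∨ m * (1 + g + 4 * δ) ≤ maxGreen x) :
    ((maxGreen (D.chain x m ω) + C * maxRed (D.chain x m ω) : ℕ) : ℝ) ≤
      (maxGreen x + C * maxRed x : ℕ) - 3 * δ * m + (1 + C) * D.deviation p r g x m ω + C := by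
  have hm0 : (0 : ℝ) ≤ m := Nat.cast_nonneg _
  have hC0 : (0 : ℝ) ≤ C := Nat.cast_nonneg _
  have hE := D.deviation_nonneg (p := p) (r := r) (g := g) (x := x) (m := m) (ω := ω)
  have hR := D.maxRed_chain_le (p := p) (r := r) (g := g) (x := x) (m := m) (ω := ω) hM
  have hηm : η * m ≤ (1 - r) / M * m := mul_le_mul_of_nonneg_right hη hm0
  have hηδm : η * m ≤ δ * m := mul_le_mul_of_nonneg_right hηδ hm0
  have hηm0 : 0 ≤ η * m := by positivity
  have hxR : (0 : ℝ) ≤ maxRed x := Nat.cast_nonneg _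
  push_cast
  -- With a long red queue, `C * η ≥ g + 3 * δ` lets the red decrease pay for the green growth. With
  -- short ones, the green drift `4 * δ` loses one `δ` to the initial red messages. Either way `3 *
  -- δ` remains.
  rcases lt_or_ge (δ * m) (maxRed x) with h | h
  · have h1 := D.maxGreen_chain_le (p := p) (r := r) (x := x) (m := m) (ω := ω) hM hg
    have h2 : (maxRed (D.chain x m ω) : ℝ) ≤
        maxRed x - η * m + D.deviation p r g x m ω + 1 :=
      hR.trans (max_le (by linarith) (by linarith))
    have h3 := mul_le_mul_of_nonneg_left h2 hC0
    have h4 := mul_le_mul_of_nonneg_right hC hm0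
    linarith
  · have hxG := hx.resolve_left h.not_gt
    have h1 := D.maxGreen_chain_le_of_short_red (ω := ω) hM hp0 hp1 hg hδ h
      (by rwa [hκ])
    have h2 : (maxRed (D.chain x m ω) : ℝ) ≤ maxRed x + D.deviation p r g x m ω + 1 :=
      hR.trans (max_le (by linarith) (by linarith))
    have h3 := mul_le_mul_of_nonneg_left h2 hC0
    rw [hκ] at h1
    linarith

end Pathwise

variable [MeasurableSpace Ω] {P : Measure Ω} {p : ℝ}

namespace IsAdmissible

variable (hD : D.IsAdmissible P p) [IsProbabilityMeasure P]

include hD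

lemma integrable_deviation (hM : 1 ≤ M) (hp0 : 0 ≤ p) (hp1 : p ≤ 1) (r g : ℝ) (x : State M)
    (m : ℕ) : Integrable (D.deviation p r g x m) P :=
  integrable_finsetSum _ fun i _ =>
    (((((hD.integrable_redArrivals hM i m).sub (integrable_const _)).abs).add
      ((hD.integrable_greenArrivals hM i m).sub (integrable_const _)).abs).add
      (hD.integrable_noise hp0 hp1 x i m).abs).add (hD.integrable_redQueue_empty hM x.turn i m)

/-- Uniformity in `x`: the state enters only through its turn, which has finitely many values, and
through the noise, whose mean absolute value is at most `√m` for every `x`. -/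
lemma eventually_integral_deviation_le (hM : 1 ≤ M) (hp0 : 0 ≤ p) (hp1 : p ≤ 1)
    (hR : ∫ ω, (D.redCount 0 ω : ℝ) ∂P < 1) {ε : ℝ} (hε : 0 < ε) :
    ∀ᶠ m : ℕ in atTop, ∀ x : State M, ∫ ω, D.deviation p (∫ ω, (D.redCount 0 ω : ℝ) ∂P)
      (∫ ω, (D.greenCount 0 ω : ℝ) ∂P) x m ω ∂P ≤ ε * m := by
  set r := ∫ ω, (D.redCount 0 ω : ℝ) ∂P
  set g := ∫ ω, (D.greenCount 0 ω : ℝ) ∂P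
  have hsqrt : Tendsto (fun m : ℕ => √(m : ℝ) / m) atTop (𝓝 0) := by
    have h : Tendsto (fun m : ℕ => (√(m : ℝ))⁻¹) atTop (𝓝 0) :=
      tendsto_inv_atTop_zero.comp (Real.tendsto_sqrt_atTop.comp tendsto_natCast_atTop_atTop)
    refine h.congr fun m => ?_
    rw [Real.sqrt_div_self', one_div]
  have hlim : ∀ c : Fin M, Tendsto (fun m : ℕ => ∑ i : Fin M,
      ((∫ ω, |D.redArrivals i m ω - m * (r / M)| ∂P) / m +
        (∫ ω, |D.greenArrivals i m ω - m * (g / M)| ∂P) / m + √(m : ℝ) / m +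
        (∫ ω, D.redQueue (emptyState c) i m ω ∂P) / m)) atTop (𝓝 0) := fun c => by
    have := tendsto_finsetSum Finset.univ fun i (_ : i ∈ (Finset.univ : Finset (Fin M))) =>
      ((((hD.tendsto_integral_redArrivals hM i).add
        (hD.tendsto_integral_greenArrivals hM i)).add hsqrt).add
        (hD.tendsto_integral_redQueue_empty hM hR c i))
    simpa using this
  have hev : ∀ᶠ m : ℕ in atTop, ∀ c : Fin M, ∑ i : Fin M,
      ((∫ ω, |D.redArrivals i m ω - m * (r / M)| ∂P) / m +
        (∫ ω, |D.greenArrivals i m ω - m * (g / M)| ∂P) / m + √(m : ℝ) / m +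
        (∫ ω, D.redQueue (emptyState c) i m ω ∂P) / m) < ε :=
    eventually_all.2 fun c => (hlim c).eventually_lt_const hε
  filter_upwards [hev, eventually_gt_atTop 0] with m hm hm0 x
  have hm0' : (0 : ℝ) < m := by exact_mod_cast hm0
  have i1 : ∀ i, Integrable (fun ω => |D.redArrivals i m ω - m * (r / M)|) P := fun i =>
    ((hD.integrable_redArrivals hM i m).sub (integrable_const _)).abs
  have i2 : ∀ i, Integrable (fun ω => |D.greenArrivals i m ω - m * (g / M)|) P := fun i =>
    ((hD.integrable_greenArrivals hM i m).sub (integrable_const _)).abs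
  have i3 : ∀ i, Integrable (fun ω => |D.noise p x i m ω|) P := fun i =>
    (hD.integrable_noise hp0 hp1 x i m).abs
  have i4 := fun i => hD.integrable_redQueue_empty hM x.turn i m
  have i12 : ∀ i, Integrable (fun ω => |D.redArrivals i m ω - m * (r / M)| +
    |D.greenArrivals i m ω - m * (g / M)|) P := fun i => (i1 i).add (i2 i)
  have i123 : ∀ i, Integrable (fun ω => |D.redArrivals i m ω - m * (r / M)| +
    |D.greenArrivals i m ω - m * (g / M)| + |D.noise p x i m ω|) P := fun i => (i12 i).add (i3 i)
  have i1234 : ∀ i, Integrable (fun ω => |D.redArrivals i m ω - m * (r / M)| +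
    |D.greenArrivals i m ω - m * (g / M)| + |D.noise p x i m ω| +
    D.redQueue (emptyState x.turn) i m ω) P := fun i => (i123 i).add (i4 i)
  have h := hm x.turn
  simp only [← add_div] at h
  rw [← Finset.sum_div, div_lt_iff₀ hm0'] at h
  refine le_trans ?_ h.le
  unfold deviation
  rw [integral_finsetSum _ fun i _ => i1234 i]
  refine Finset.sum_le_sum fun i _ => ?_
  rw [integral_add (i123 i) (i4 i), integral_add (i12 i) (i3 i), integral_add (i1 i) (i2 i)]
  gcongr
  exact hD.integral_abs_noise_le hp0 hp1 x i m

lemma integrable_lyapunov (hM : 1 ≤ M) (C : ℕ) (x : State M) (n : ℕ) :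
    Integrable (fun ω => ((maxGreen (D.chain x n ω) + C * maxRed (D.chain x n ω) : ℕ) : ℝ)) P := by
  have hi : Integrable (fun ω => ∑ j, (x.green j + D.greenArrivals j n ω) +
      C * ∑ j, (x.red j + D.redArrivals j n ω)) P :=
    (integrable_finsetSum _ fun j _ => (integrable_const _).add
      (hD.integrable_greenArrivals hM j n)).add
      ((integrable_finsetSum _ fun j _ => (integrable_const _).add
        (hD.integrable_redArrivals hM j n)).const_mul _)
  refine hi.mono' ((measurable_of_countable fun y : State M =>
    ((maxGreen y + C * maxRed y : ℕ) : ℝ)).comp (hD.measurable_chain x n)).aestronglyMeasurable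
    (.of_forall fun ω => ?_)
  rw [Real.norm_eq_abs, abs_of_nonneg (Nat.cast_nonneg _)]
  push_cast
  have hA : ∀ j, 0 ≤ D.greenArrivals j n ω := fun j =>
    Finset.sum_nonneg fun _ _ => Nat.cast_nonneg _
  have hB : ∀ j, 0 ≤ D.redArrivals j n ω := fun j => D.redArrivals_nonneg j n ω
  gcongr
  · refine cast_sup_univ_le hM fun j => (D.green_chain_le x j n ω).trans ?_
    exact Finset.single_le_sum (f := fun j => (x.green j : ℝ) + D.greenArrivals j n ω)
      (fun i _ => add_nonneg (Nat.cast_nonneg _) (hA i)) (Finset.mem_univ j)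
  · refine cast_sup_univ_le hM fun j => ?_
    have h1 := D.redQueue_le_add x j n ω
    have h2 := D.redQueue_empty_le_arrivals x.turn j n ω
    have h3 := Finset.single_le_sum (f := fun j => (x.red j : ℝ) + D.redArrivals j n ω)
      (fun i _ => add_nonneg (Nat.cast_nonneg _) (hB i)) (Finset.mem_univ j)
    exact (h1.trans (add_le_add_right h2 _)).trans h3

theorem isStable_of_lt_serviceRate (hM : 1 ≤ M) (hp0 : 0 ≤ p) (hp1 : p ≤ 1)
    (hR : ∫ ω, (D.redCount 0 ω : ℝ) ∂P < 1)
    (hG : (∫ ω, (D.greenCount 0 ω : ℝ) ∂P) / M <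
      serviceRate M p (∫ ω, (D.redCount 0 ω : ℝ) ∂P))
    (hz : ∃ z : State M, ∀ x, ∃ n, 1 ≤ n ∧ 0 < P {ω | D.chain x n ω = z}) : D.IsStable P := by
  have hM0 : (0 : ℝ) < M := by exact_mod_cast hM
  obtain ⟨z, hz⟩ := hz
  set r := ∫ ω, (D.redCount 0 ω : ℝ) ∂P with hr
  set g := ∫ ω, (D.greenCount 0 ω : ℝ) ∂P with hg_def
  have hg : 0 ≤ g := integral_nonneg fun _ => Nat.cast_nonneg _
  -- A quarter of the spare capacity: one part is lost to initial red messages, one to the mean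
  -- deviation, and the remaining `2 * δ * m` must exceed `C + 1`, which fixes `m`.
  set δ := (serviceRate M p r - g / M) / 4 with hδ_def
  have hδ : 0 < δ := div_pos (sub_pos.2 hG) (by norm_num)
  have hκ : serviceRate M p r - g / M = 4 * δ := by rw [hδ_def]; ring
  set η := min ((1 - r) / M) δ with hη_def
  have hη0 : 0 < η := lt_min (div_pos (by linarith) hM0) hδ
  have hη1 : η ≤ (1 - r) / M := min_le_left _ _
  have hη2 : η ≤ δ := min_le_right _ _
  obtain ⟨C, hC⟩ := exists_nat_ge ((g + 3 * δ) / η)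
  rw [div_le_iff₀ hη0] at hC
  have hC0 : (0 : ℝ) ≤ C := Nat.cast_nonneg _
  obtain ⟨m₀, hm₀⟩ := exists_nat_ge ((C + 1) / (2 * δ))
  obtain ⟨m, hdev, hm⟩ := ((hD.eventually_integral_deviation_le hM hp0 hp1 hR
    (ε := δ / (1 + C)) (by positivity)).and (eventually_ge_atTop (m₀ + 1))).exists
  have hmδ : C + 1 ≤ 2 * δ * m := by
    rw [div_le_iff₀ (by positivity)] at hm₀
    have : (m₀ : ℝ) ≤ m := by exact_mod_cast (by omega : m₀ ≤ m)
    nlinarith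
  -- Above this level, either `maxRed` or `maxGreen` exceeds its threshold in `lyapunov_chain_le`.
  obtain ⟨K, hK⟩ := exists_nat_ge (m * (1 + g + 4 * δ) + C * (δ * m))
  -- A positive weight is needed for the sublevel sets to bound the red queues too, hence to be
  -- finite.
  have hC1 : 1 ≤ C := by
    rcases Nat.eq_zero_or_pos C with rfl | h
    · rw [Nat.cast_zero, zero_mul] at hC
      linarith
    · exact h
  set V : State M → ℕ := fun x => maxGreen x + C * maxRed x with hV
  have hlint : ∀ x n, ∫⁻ ω, (V (D.chain x n ω) : ℝ≥0∞) ∂P =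
      ENNReal.ofReal (∫ ω, (V (D.chain x n ω) : ℝ) ∂P) := fun x n => by
    rw [ofReal_integral_eq_lintegral_ofReal (hD.integrable_lyapunov hM C x n)
      (.of_forall fun ω => Nat.cast_nonneg _)]
    simp only [ENNReal.ofReal_natCast]
    rfl
  refine ⟨z, hD.positiveRecurrentSet_of_drift z V K m (by omega) ?_ ?_ ?_ hz⟩
  · refine (finite_setOf_max_le K K).subset fun x hx => ⟨?_, ?_⟩
    · have : maxGreen x + C * maxRed x ≤ K := hx
      nlinarith
    · exact (Nat.le_add_right _ _).trans hx
  · intro x n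
    rw [hlint]
    exact ENNReal.ofReal_lt_top
  · intro x hx
    have hlarge : δ * m < maxRed x ∨ m * (1 + g + 4 * δ) ≤ maxGreen x := by
      by_contra! h
      have h1 : (K : ℝ) < maxGreen x + C * maxRed x := by exact_mod_cast hx
      have h2 : C * (maxRed x : ℝ) ≤ C * (δ * m) := mul_le_mul_of_nonneg_left h.1 hC0
      linarith
    have hmean : ∫ ω, (V (D.chain x m ω) : ℝ) ∂P ≤ V x - 1 := by
      have hid := hD.integrable_deviation hM hp0 hp1 r g x m
      have hi2 : Integrable (fun ω => (V x : ℝ) - 3 * δ * m +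
          (1 + C) * D.deviation p r g x m ω + C) P :=
        ((integrable_const _).add (hid.const_mul _)).add (integrable_const _)
      have hi1 : Integrable (fun ω => (V x : ℝ) - 3 * δ * m +
          (1 + C) * D.deviation p r g x m ω) P :=
        (integrable_const _).add (hid.const_mul _)
      calc ∫ ω, (V (D.chain x m ω) : ℝ) ∂P
          ≤ ∫ ω, ((V x : ℝ) - 3 * δ * m + (1 + C) * D.deviation p r g x m ω + C) ∂P :=
            integral_mono (hD.integrable_lyapunov hM C x m) hi2 fun ω =>
              D.lyapunov_chain_le hM hp0 hp1 hg hδ.le hκ hη1 hη0.le hη2 hC hlarge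
        _ = (V x : ℝ) - 3 * δ * m + (1 + C) * ∫ ω, D.deviation p r g x m ω ∂P + C := by
            rw [integral_add hi1 (integrable_const _),
              integral_add (integrable_const _) (hid.const_mul _), integral_const_mul]
            simp
        _ ≤ (V x : ℝ) - 3 * δ * m + (1 + C) * (δ / (1 + C) * m) + C := by
            gcongr
            exact hdev x
        _ = (V x : ℝ) - 2 * δ * m + C := by field_simp; ring
        _ ≤ V x - 1 := by linarith
    have hV1 : (1 : ℝ) ≤ V x := by exact_mod_cast (by omega : 1 ≤ V x)
    rw [hlint]
    calc ENNReal.ofReal (∫ ω, (V (D.chain x m ω) : ℝ) ∂P) + 1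
        ≤ ENNReal.ofReal (V x - 1) + ENNReal.ofReal 1 := by
          rw [ENNReal.ofReal_one]
          gcongr
      _ = V x := by
          rw [← ENNReal.ofReal_add (by linarith) zero_le_one, sub_add_cancel,
            ENNReal.ofReal_natCast]

end IsAdmissible

end Inputs

end AlohaMac

/-! ### The capacity formula and the theorem -/

namespace AlohaMac

/-- This is the binomial probability of exactly one success in `n` trials, a single term in the
expansion of `(p + (1 - p)) ^ n`. -/
lemma natCast_mul_prob_le_one {p : ℝ} (hp0 : 0 ≤ p) (hp1 : p ≤ 1) (n : ℕ) :
    n * p * (1 - p) ^ (n - 1) ≤ 1 := by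
  rcases Nat.eq_zero_or_pos n with rfl | hn
  · simp
  have hq0 : 0 ≤ 1 - p := by linarith
  have h := add_pow p (1 - p) n
  rw [add_sub_cancel, one_pow] at h
  have h1 := Finset.single_le_sum (f := fun k => p ^ k * (1 - p) ^ (n - k) * (n.choose k : ℝ))
    (fun k _ => by positivity) (Finset.mem_range.2 (by omega : 1 < n + 1))
  rw [← h] at h1
  simp only [pow_one, Nat.choose_one_right] at h1
  linarith

lemma natCast_mul_serviceRate {M : ℕ} (hM : 1 ≤ M) (p r : ℝ) :
    M * serviceRate M p r = r * ((M : ℝ) - 1) * p * (1 - p) ^ (M - 2) +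
      (1 - r) * M * p * (1 - p) ^ (M - 1) := by
  have hM0 : (M : ℝ) ≠ 0 := by exact_mod_cast (by omega : M ≠ 0)
  rw [serviceRate]
  field_simp
  ring

/-- A convex combination of two such probabilities. It forces `λ_G < 1` below capacity, so slots
without green arrivals have positive probability. -/
lemma natCast_mul_serviceRate_le_one {M : ℕ} (hM : 1 ≤ M) {p r : ℝ} (hp0 : 0 ≤ p) (hp1 : p ≤ 1)
    (hr0 : 0 ≤ r) (hr1 : r ≤ 1) : M * serviceRate M p r ≤ 1 := by
  have h1 := natCast_mul_prob_le_one hp0 hp1 (M - 1)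
  have h2 := natCast_mul_prob_le_one hp0 hp1 M
  rw [Nat.cast_sub hM, Nat.cast_one, Nat.sub_sub] at h1
  have h3 := mul_le_mul_of_nonneg_left h1 hr0
  have h4 := mul_le_mul_of_nonneg_left h2 (sub_nonneg.2 hr1)
  rw [natCast_mul_serviceRate hM]
  linarith

/-- A random variable with values in `ℕ` whose mean is less than one vanishes with positive
probability. -/
lemma measure_eq_zero_pos_of_integral_lt_one {Ω : Type*} [MeasurableSpace Ω] {P : Measure Ω}
    [IsProbabilityMeasure P] {N : Ω → ℕ} (hint : Integrable (fun ω => (N ω : ℝ)) P)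
    (h : ∫ ω, (N ω : ℝ) ∂P < 1) : 0 < P {ω | N ω = 0} := by
  by_contra h0
  have h1 : ∀ᵐ ω ∂P, N ω ≠ 0 := by
    rw [ae_iff]
    simpa using h0
  have : ∫ _, (1 : ℝ) ∂P ≤ ∫ ω, (N ω : ℝ) ∂P := by
    refine integral_mono_ae (integrable_const _) hint ?_
    filter_upwards [h1] with ω hω
    exact_mod_cast Nat.one_le_iff_ne_zero.2 hω
  simp at this
  linarith

/-- A random variable with values in `ℕ` whose mean is positive has a positive value with
positive probability. -/
lemma exists_measure_eq_pos_of_integral_pos {Ω : Type*} [MeasurableSpace Ω] {P : Measure Ω}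
    {N : Ω → ℕ} (h : 0 < ∫ ω, (N ω : ℝ) ∂P) : ∃ k, 1 ≤ k ∧ 0 < P {ω | N ω = k} := by
  by_contra! h0
  have h1 : ∀ᵐ ω ∂P, ∀ k : ℕ, 1 ≤ k → N ω ≠ k := by
    refine ae_all_iff.2 fun k => ?_
    by_cases hk : 1 ≤ k
    · have : ∀ᵐ ω ∂P, N ω ≠ k := by
        rw [ae_iff]
        simpa using h0 k hk
      filter_upwards [this] with ω hω _ using hω
    · exact .of_forall fun ω h => absurd h hk
  have : ∫ ω, (N ω : ℝ) ∂P = 0 := by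
    refine integral_eq_zero_of_ae ?_
    filter_upwards [h1] with ω hω
    by_contra hne
    exact hω (N ω) (Nat.one_le_iff_ne_zero.2 fun h => hne (by simp [h])) rfl
  linarith

namespace Inputs.IsAdmissible

variable {Ω : Type*} [MeasurableSpace Ω] {P : Measure Ω} [IsProbabilityMeasure P] {M : ℕ}
  {D : Inputs Ω M} {p : ℝ}

theorem isStable_of_lt_mul_serviceRate (hD : D.IsAdmissible P p) (hM : 1 ≤ M) (hp0 : 0 ≤ p)
    (hp1 : p ≤ 1) (hR : ∫ ω, (D.redCount 0 ω : ℝ) ∂P < 1)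
    (hG : ∫ ω, (D.greenCount 0 ω : ℝ) ∂P <
      M * serviceRate M p (∫ ω, (D.redCount 0 ω : ℝ) ∂P)) : D.IsStable P := by
  have hM0 : (0 : ℝ) < M := by exact_mod_cast hM
  have hr0 : 0 ≤ ∫ ω, (D.redCount 0 ω : ℝ) ∂P := integral_nonneg fun _ => Nat.cast_nonneg _
  have hg0 : 0 ≤ ∫ ω, (D.greenCount 0 ω : ℝ) ∂P := integral_nonneg fun _ => Nat.cast_nonneg _
  have hpos := hg0.trans_lt hG
  have hle := natCast_mul_serviceRate_le_one hM hp0 hp1 hr0 hR.le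
  rw [natCast_mul_serviceRate hM] at hpos
  have hp : 0 < p := hp0.lt_of_ne fun h => by simp [← h] at hpos
  refine hD.isStable_of_lt_serviceRate hM hp0 hp1 hR ((div_lt_iff₀' hM0).2 hG) ?_
  refine hD.exists_accessible hM hp
    (measure_eq_zero_pos_of_integral_lt_one hD.integrable_redCount hR)
    (measure_eq_zero_pos_of_integral_lt_one hD.integrable_greenCount (by linarith)) ?_
  rcases hp1.lt_or_eq with hp1' | rfl
  · exact Or.inl hp1'
  rcases hM.eq_or_lt with hM1 | hM1
  · exact Or.inr (Or.inl hM1.symm)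
  rcases (Nat.succ_le_of_lt hM1).eq_or_lt with hM2 | hM2
  -- For `p = 1` and `M = 2` the capacity equals `λ_R`, so its positivity means that red messages do
  -- arrive.
  · refine Or.inr (Or.inr ⟨hM2.symm, exists_measure_eq_pos_of_integral_pos ?_⟩)
    subst hM2
    norm_num at hpos
    exact hpos
  -- For `p = 1` and `M ≥ 3` both powers of `1 - p` have positive exponents, so the capacity would
  -- be zero.
  · rw [sub_self, zero_pow (by omega), zero_pow (by omega)] at hpos
    simp at hpos

theorem isUnstable_of_mul_serviceRate_lt (hD : D.IsAdmissible P p) (hM : 1 ≤ M) (hp0 : 0 ≤ p)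
    (hp1 : p ≤ 1) (hR : ∫ ω, (D.redCount 0 ω : ℝ) ∂P < 1)
    (hG : M * serviceRate M p (∫ ω, (D.redCount 0 ω : ℝ) ∂P) <
      ∫ ω, (D.greenCount 0 ω : ℝ) ∂P) : D.IsUnstable P := by
  have hM0 : (0 : ℝ) < M := by exact_mod_cast hM
  exact hD.isUnstable_of_serviceRate_lt hM hp0 hp1 hR ((lt_div_iff₀' hM0).2 hG)

end Inputs.IsAdmissible

end AlohaMac

theorem theorem3 {Ω : Type*} [MeasurableSpace Ω] (P : Measure Ω) [IsProbabilityMeasure P]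
    (M : ℕ) (hM : 1 ≤ M) (p : ℝ) (hp0 : 0 ≤ p) (hp1 : p ≤ 1)
    (D : AlohaMac.Inputs Ω M) (hD : D.IsAdmissible P p)
    (lamR lamG : ℝ)
    (hlamR : lamR = ∫ ω, (D.redCount 0 ω : ℝ) ∂P)
    (hlamG : lamG = ∫ ω, (D.greenCount 0 ω : ℝ) ∂P)
    (hR : lamR < 1) :
    (M = 1 →
      (lamG < (1 - lamR) * p → D.IsStable P) ∧
      (lamG > (1 - lamR) * p → D.IsUnstable P)) ∧
    (1 < M →
      (lamG < lamR * ((M : ℝ) - 1) * p * (1 - p) ^ (M - 2)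
          + (1 - lamR) * (M : ℝ) * p * (1 - p) ^ (M - 1) → D.IsStable P) ∧
      (lamG > lamR * ((M : ℝ) - 1) * p * (1 - p) ^ (M - 2)
          + (1 - lamR) * (M : ℝ) * p * (1 - p) ^ (M - 1) → D.IsUnstable P)) := by
  have hrate := AlohaMac.natCast_mul_serviceRate hM p lamR
  have hstable : lamG < M * AlohaMac.serviceRate M p lamR → D.IsStable P := fun h => by
    subst hlamR hlamG
    exact hD.isStable_of_lt_mul_serviceRate hM hp0 hp1 hR h
  have hunstable : M * AlohaMac.serviceRate M p lamR < lamG → D.IsUnstable P := fun h => by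
    subst hlamR hlamG
    exact hD.isUnstable_of_mul_serviceRate_lt hM hp0 hp1 hR h
  rw [hrate] at hstable hunstable
  refine ⟨fun h1 => ?_, fun _ => ⟨hstable, hunstable⟩⟩
  -- For `M = 1` the truncated exponent `M - 2` is harmless, because its term carries the factor `M
  -- - 1 = 0`.
  have hone : lamR * ((M : ℝ) - 1) * p * (1 - p) ^ (M - 2) +
      (1 - lamR) * M * p * (1 - p) ^ (M - 1) = (1 - lamR) * p := by
    subst h1
    simp
  rw [hone] at hstable hunstable
  exact ⟨hstable, hunstable⟩
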